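/- Fix $\mathfrak m\in\mathbb R$, $\alpha>0$ and a probability space $(\Omega,\mathcal F,\mathbb P)$. Let $\mathcal E$ be the set of functions $f:\mathbb R^2\to\mathbb R$ such that $\sup_{x\in\mathbb R^2}|f(x)|e^{-\lambda|x|}<\infty$ for some $\lambda>0$. Let $v_0$ be a (jointly measurable) random field on $\mathbb R^2$ such that $v_0\in\mathcal E$ almost surely and $$C_0:=\sup_{x\in\mathbb R^2}\mathbb E[v_0(x)^2]<\infty .$$ Consider the mean-field equation $$\partial_t v=\tfrac12\Delta v+\mathfrak m\,v-\alpha\,\mathbb E[v^2]\,v\quad\text{on }(0,\infty)\times\mathbb R^2,\qquad v(0,\cdot)=v_0. \qquad (\ast)$$ A random field $v=(v(t,x))_{t\ge 0,\,x\in\mathbb R^2}$ is called a solution of $(\ast)$ if every $v(t,x)$ is a square-integrable random variable and 1. almost surely, $v$ is $C^\infty$ on $(0,\infty)\times\mathbb R^2$ and satisfies the equation at every point of $(0,\infty)\times\mathbb R^2$; 2. almost surely, $v(0,x)=v_0(x)$ for all $x\in\mathbb R^2$, and $\lim_{t\downarrow0}v(t,x)=v_0(x)$ for Lebesgue-almost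 every $x\in\mathbb R^2$; 3. for every $T\in(0,\infty)$, the function $x\mapsto\sup_{0\le s\le T}|v(s,x)|$ is almost surely finite and in $\mathcal E$, and the function $x\mapsto\sup_{0\le s\le T}\mathbb E[v(s,x)^2]$ is finite and in $\mathcal E$. Then $(\ast)$ has at most one solution: if $u$ and $v$ are two solutions with the same initial data $v_0$, then almost surely $u(t,x)=v(t,x)$ for all $t\ge0$ and $x\in\mathbb R^2$. -/

import Mathlib

open MeasureTheory Filter Topology

namespace MeanField

/-- The Euclidean plane `ℝ²`. -/
abbrev Plane : Type := EuclideanSpace ℝ (Fin 2)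

/-- The set `𝓔` of functions `f : ℝ² → ℝ` of at most exponential growth: for some `r > 0`,
`sup_x |f x| e^{-r |x|} < ∞`. -/
def ExpGrowth : Set (Plane → ℝ) :=
  {f | ∃ r : ℝ, 0 < r ∧ BddAbove (Set.range fun x : Plane => |f x| * Real.exp (-r * ‖x‖))}

/-- The function `x ↦ sup_{0 ≤ s ≤ T} g s x` is finite everywhere and belongs to `𝓔`.
The supremum is a least upper bound, so that it has to be finite. -/
def SupInExpGrowth (T : ℝ) (g : ℝ → Plane → ℝ) : Prop :=
  ∃ f ∈ ExpGrowth, ∀ x : Plane, IsLUB ((fun s : ℝ => g s x) '' Set.Icc 0 T) (f x)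

/-- `v` (a random field `v ω t x`, used at times `t ≥ 0` only) solves
`∂ₜ v = ½ Δ v + m v - α 𝔼[v²] v` on `(0, ∞) × ℝ²` with initial condition `v₀`.

The initial condition holds at time `0`, and is the limit of `v ω t x` as `t ↓ 0` for almost
every `x`. As `v₀ ω` need not be continuous, convergence at every `x` is not required. -/
structure IsSolution {Ω : Type*} [MeasurableSpace Ω] (P : Measure Ω) (m α : ℝ)
    (v₀ : Ω → Plane → ℝ) (v : Ω → ℝ → Plane → ℝ) : Prop where
  /-- `v (t, x)` is a square-integrable random variable. -/
  memLp : ∀ t : ℝ, 0 ≤ t → ∀ x : Plane, MemLp (fun ω => v ω t x) 2 P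
  /-- Almost every path is smooth on `(0, ∞) × ℝ²`. -/
  smooth : ∀ᵐ ω ∂P,
    ContDiffOn ℝ ((⊤ : ℕ∞) : WithTop ℕ∞) (fun p : ℝ × Plane => v ω p.1 p.2) (Set.Ioi 0 ×ˢ Set.univ)
  /-- Almost every path satisfies the equation at every point of `(0, ∞) × ℝ²`. -/
  equation : ∀ᵐ ω ∂P, ∀ t : ℝ, 0 < t → ∀ x : Plane,
    deriv (fun s : ℝ => v ω s x) t =
      1 / 2 * Laplacian.laplacian (fun y : Plane => v ω t y) x + m * v ω t x
        - α * (∫ ω', (v ω' t x) ^ 2 ∂P) * v ω t x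
  /-- Initial value. -/
  initial : ∀ᵐ ω ∂P, ∀ x : Plane, v ω 0 x = v₀ ω x
  /-- The initial value is attained as `t ↓ 0`. -/
  tendsto_initial : ∀ᵐ ω ∂P, ∀ᵐ x : Plane,
    Tendsto (fun t : ℝ => v ω t x) (𝓝[>] 0) (𝓝 (v₀ ω x))
  /-- `x ↦ sup_{0 ≤ s ≤ T} |v (s, x)|` belongs to `𝓔` almost surely. -/
  growth : ∀ T : ℝ, 0 < T → ∀ᵐ ω ∂P, SupInExpGrowth T fun s x => |v ω s x|
  /-- `x ↦ sup_{0 ≤ s ≤ T} 𝔼[v (s, x)²]` belongs to `𝓔`. -/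
  growth_sq : ∀ T : ℝ, 0 < T → SupInExpGrowth T fun s x => ∫ ω, (v ω s x) ^ 2 ∂P

end MeanField

/-! Uniqueness is a weighted energy estimate for the difference `w = u - v`. With `g = e^{4(t-T)}`
and `γ = exp(-m t - g |x|²)`, the time derivative of `γ²` cancels the reaction term `m w` and
absorbs the terms that integration by parts produces from `∇γ`; the Gaussian decay of `γ` beats any
exponential growth. What remains is a cutoff error and the nonlinear term, `-2 ∫ γ² w N`.

That term has no sign path by path, but its expectation does: `X ↦ 𝔼[X²] X` is monotone in `L²`
(`integral_sub_mul_meanField_nonneg`). Taking expectations needs integrability, whereas the growth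
constants of a path depend on `ω` with no moment control. The remedy is to treat each solution
separately first: `α 𝔼[v²] v` is damping along every path, so `energy_le_initial` bounds the energy
of `v` by that of `v₀`. This random variable is integrable because `𝔼[v₀(x)²]` is bounded, and four
times it dominates the energy of `w` at all times in `(0, T]`.

Localization in space and starting at time `s > 0` make Fubini available for the nonlinear term
(`integrable_dissipation`). In the expected inequality, `s ↓ 0` removes the initial energy and
widening the cutoff removes the error, both by dominated convergence. Hence `w` vanishes at each
fixed time almost surely; rational times and continuity give all times. -/

namespace MeanField

/-! ### Green's inequality with a compactly supported weight. -/

section Deterministic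

variable {E : Type*} [NormedAddCommGroup E] [InnerProductSpace ℝ E] [FiniteDimensional ℝ E]
  [MeasurableSpace E] [BorelSpace E]

/-- Weighted Green inequality: `∫ ψ² f Δf ≤ ∫ f² |∇ψ|²` for compactly supported `ψ`. -/
theorem integral_sq_mul_mul_laplacian_le {ι : Type*} [Fintype ι] (b : OrthonormalBasis ι ℝ E)
    {f ψ : E → ℝ} (hf : ContDiff ℝ 2 f) (hψ : ContDiff ℝ 1 ψ) (hc : HasCompactSupport ψ) :
    ∫ x, ψ x ^ 2 * (f x * Laplacian.laplacian f x) ≤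
      ∫ x, f x ^ 2 * ∑ i, (fderiv ℝ ψ x (b i)) ^ 2 := by
  have hf1 : ContDiff ℝ 1 (fderiv ℝ f) := hf.fderiv_right (by norm_num)
  have hD : ∀ i, ContDiff ℝ 1 fun x => fderiv ℝ f x (b i) := fun i =>
    hf1.clm_apply contDiff_const
  have hfd : Differentiable ℝ f := hf.differentiable (by norm_num)
  have hψd : Differentiable ℝ ψ := hψ.differentiable (by norm_num)
  have hψ1 : ∀ i, Continuous fun x => fderiv ℝ ψ x (b i) := fun i =>
    (hψ.continuous_fderiv (by norm_num)).clm_apply continuous_const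
  have hDD : ∀ i, Continuous fun x => fderiv ℝ (fun y => fderiv ℝ f y (b i)) x (b i) := fun i =>
    ((hD i).continuous_fderiv (by norm_num)).clm_apply continuous_const
  have hlap : ∀ x, Laplacian.laplacian f x =
      ∑ i, fderiv ℝ (fun y => fderiv ℝ f y (b i)) x (b i) := by
    intro x
    rw [InnerProductSpace.laplacian_eq_iteratedFDeriv_orthonormalBasis f b]
    refine Finset.sum_congr rfl fun i _ => ?_
    rw [iteratedFDeriv_two_apply, fderiv_clm_apply (hf1.differentiable (by norm_num) x)
      (differentiableAt_const _)]
    simp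
  have hψs : ∀ x, x ∉ tsupport ψ → ψ x = 0 := fun x hx => image_eq_zero_of_notMem_tsupport hx
  have hψs' : ∀ x, x ∉ tsupport ψ → fderiv ℝ ψ x = 0 := fun x hx =>
    image_eq_zero_of_notMem_tsupport fun h => hx (tsupport_fderiv_subset ℝ h)
  have hcs : ∀ h : E → ℝ, (∀ x, x ∉ tsupport ψ → h x = 0) → HasCompactSupport h := fun h hh =>
    HasCompactSupport.intro hc hh
  have hfderiv : ∀ i x, fderiv ℝ (fun y => ψ y ^ 2 * f y) x (b i) =
      2 * ψ x * fderiv ℝ ψ x (b i) * f x + ψ x ^ 2 * fderiv ℝ f x (b i) := by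
    intro i x
    rw [fderiv_fun_mul ((hψd x).fun_pow 2) (hfd x), fderiv_fun_pow 2 (hψd x)]
    simp; ring
  have hcont : Continuous fun x => ψ x ^ 2 * f x := (hψ.continuous.pow 2).mul hf.continuous
  have hI1 : ∀ i, Integrable fun x =>
      ψ x ^ 2 * f x * fderiv ℝ (fun y => fderiv ℝ f y (b i)) x (b i) := fun i =>
    (hcont.mul (hDD i)).integrable_of_hasCompactSupport (hcs _ fun x hx => by simp [hψs x hx])
  have hI2 : ∀ i, Integrable fun x => f x ^ 2 * (fderiv ℝ ψ x (b i)) ^ 2 := fun i =>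
    ((hf.continuous.pow 2).mul ((hψ1 i).pow 2)).integrable_of_hasCompactSupport
      (hcs _ fun x hx => by simp [hψs' x hx])
  have hI3 : ∀ i, Integrable fun x =>
      fderiv ℝ (fun y => ψ y ^ 2 * f y) x (b i) * fderiv ℝ f x (b i) := fun i => by
    simp only [hfderiv]
    refine Continuous.integrable_of_hasCompactSupport ?_ (hcs _ fun x hx => by simp [hψs x hx])
    have := hψ.continuous
    have := hf.continuous
    have := hψ1 i
    have := (hD i).continuous
    fun_prop
  have hibp : ∀ i, ∫ x, ψ x ^ 2 * f x * fderiv ℝ (fun y => fderiv ℝ f y (b i)) x (b i) =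
      -∫ x, fderiv ℝ (fun y => ψ y ^ 2 * f y) x (b i) * fderiv ℝ f x (b i) := fun i =>
    integral_mul_fderiv_eq_neg_fderiv_mul_of_integrable (hI3 i) (hI1 i)
      ((hcont.mul (hD i).continuous).integrable_of_hasCompactSupport
        (hcs _ fun x hx => by simp [hψs x hx]))
      (fun x _ => ((hψd x).pow 2).mul (hfd x)) (fun x _ => (hD i).differentiable (by norm_num) x)
  calc ∫ x, ψ x ^ 2 * (f x * Laplacian.laplacian f x)
      = ∑ i, ∫ x, ψ x ^ 2 * f x * fderiv ℝ (fun y => fderiv ℝ f y (b i)) x (b i) := by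
        rw [← integral_finsetSum _ fun i _ => hI1 i]
        refine integral_congr_ae (.of_forall fun x => ?_)
        simp only [hlap, ← Finset.mul_sum]; ring
    _ ≤ ∑ i, ∫ x, f x ^ 2 * (fderiv ℝ ψ x (b i)) ^ 2 := by
        refine Finset.sum_le_sum fun i _ => ?_
        rw [hibp, ← integral_neg]
        refine integral_mono (hI3 i).neg (hI2 i) fun x => ?_
        simp only [hfderiv]
        -- Expanding the square bounds the cross term `-2 ψ f ∂ᵢψ ∂ᵢf` by `ψ² (∂ᵢf)² + f² (∂ᵢψ)²`;
        -- the first summand cancels the gradient energy.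
        nlinarith [sq_nonneg (ψ x * fderiv ℝ f x (b i) + f x * fderiv ℝ ψ x (b i))]
    _ = ∫ x, f x ^ 2 * ∑ i, (fderiv ℝ ψ x (b i)) ^ 2 := by
        rw [← integral_finsetSum _ fun i _ => hI2 i]
        refine integral_congr_ae (.of_forall fun x => ?_)
        simp only [Finset.mul_sum]

end Deterministic

/-! ### The Gaussian weight and its derivatives. -/

section GaussWeight

variable {E : Type*} [NormedAddCommGroup E]

/-- The backward-heat-type weight `exp (-m t - e^{4 (t - T)} |x|²)`. -/
noncomputable def gaussWeight (m T t : ℝ) (x : E) : ℝ :=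
  Real.exp (-m * t - Real.exp (4 * (t - T)) * ‖x‖ ^ 2)

theorem gaussWeight_pos (m T t : ℝ) (x : E) : 0 < gaussWeight m T t x := Real.exp_pos _

theorem continuous_gaussWeight (m T : ℝ) :
    Continuous fun p : ℝ × E => gaussWeight m T p.1 p.2 := by
  unfold gaussWeight
  fun_prop

theorem hasDerivAt_gaussWeight (m T t : ℝ) (x : E) :
    HasDerivAt (fun r => gaussWeight m T r x)
      (gaussWeight m T t x * (-m - 4 * Real.exp (4 * (t - T)) * ‖x‖ ^ 2)) t := by
  unfold gaussWeight
  have h1 : HasDerivAt (fun r : ℝ => 4 * (r - T)) 4 t := by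
    simpa using ((hasDerivAt_id t).sub_const T).const_mul 4
  have h2 := ((hasDerivAt_id t).const_mul (-m)).fun_sub (h1.exp.mul_const (‖x‖ ^ 2))
  exact h2.exp.congr_deriv (by simp only [id_eq]; ring)

variable [InnerProductSpace ℝ E]

theorem contDiff_gaussWeight (m T t : ℝ) {n : WithTop ℕ∞} :
    ContDiff ℝ n (gaussWeight m T t : E → ℝ) := by
  unfold gaussWeight
  exact Real.contDiff_exp.comp (contDiff_const.sub (contDiff_const.mul (contDiff_norm_sq ℝ)))

theorem fderiv_gaussWeight (m T t : ℝ) (x e : E) :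
    fderiv ℝ (gaussWeight m T t) x e =
      -2 * Real.exp (4 * (t - T)) * inner ℝ x e * gaussWeight m T t x := by
  have h1 := (((hasStrictFDerivAt_norm_sq x).hasFDerivAt.const_mul
    (Real.exp (4 * (t - T)))).const_sub (-m * t)).exp
  have h2 : fderiv ℝ (gaussWeight m T t) x = _ := h1.fderiv
  rw [h2]
  simp [gaussWeight]; ring

/-- Young's inequality separates `∇γ` from `∇χ` and gives `8 g² |x|²` with `g = e^{4(t-T)}`. Since
`t ≤ T`, `g² ≤ g`, so the first term is exactly what the time derivative of `γ²` absorbs; this fixes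
the rate 4 in the weight. -/
theorem sum_fderiv_gaussWeight_mul_sq_le {ι : Type*} [Fintype ι] (b : OrthonormalBasis ι ℝ E)
    (m : ℝ) {T t : ℝ} (ht : t ≤ T) {χ : E → ℝ} (hχ : Differentiable ℝ χ) (x : E) :
    ∑ i, (fderiv ℝ (fun y => gaussWeight m T t y * χ y) x (b i)) ^ 2 ≤
      8 * Real.exp (4 * (t - T)) * ‖x‖ ^ 2 * (gaussWeight m T t x * χ x) ^ 2 +
        2 * (gaussWeight m T t x ^ 2 * ∑ i, (fderiv ℝ χ x (b i)) ^ 2) := by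
  set g := Real.exp (4 * (t - T)) with hg
  have hg0 : 0 < g := Real.exp_pos _
  have hg1 : g ≤ 1 := Real.exp_le_one_iff.2 (by linarith)
  set γ := gaussWeight m T t x with hγ
  have key : ∀ i, (fderiv ℝ (fun y => gaussWeight m T t y * χ y) x (b i)) ^ 2 ≤
      8 * g ^ 2 * (γ * χ x) ^ 2 * (inner ℝ x (b i)) ^ 2 +
        2 * γ ^ 2 * (fderiv ℝ χ x (b i)) ^ 2 := by
    intro i
    rw [fderiv_fun_mul ((contDiff_gaussWeight m T t (n := 1)).differentiable (by norm_num) x)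
      (hχ x)]
    simp only [add_apply, smul_apply, smul_eq_mul,
      fderiv_gaussWeight, ← hg, ← hγ]
    nlinarith [sq_nonneg (γ * fderiv ℝ χ x (b i) + 2 * g * (inner ℝ x (b i)) * γ * χ x)]
  refine (Finset.sum_le_sum fun i _ => key i).trans ?_
  have hn : ∑ i, (inner ℝ x (b i)) ^ 2 = ‖x‖ ^ 2 := by
    simpa using b.sum_sq_norm_inner_left x
  rw [Finset.sum_add_distrib, ← Finset.mul_sum, ← Finset.mul_sum, hn]
  have : g ^ 2 ≤ g := by nlinarith
  have h3 : 0 ≤ (γ * χ x) ^ 2 * ‖x‖ ^ 2 := by positivity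
  nlinarith

end GaussWeight

/-! ### Time and space slices of a smooth path. -/

section Slices

variable {E : Type*} [NormedAddCommGroup E] [NormedSpace ℝ E] {w : ℝ → E → ℝ}

theorem contDiff_slice (hw : ContDiffOn ℝ ((⊤ : ℕ∞) : WithTop ℕ∞) (fun p : ℝ × E => w p.1 p.2)
    (Set.Ioi 0 ×ˢ Set.univ)) {τ : ℝ} (hτ : 0 < τ) : ContDiff ℝ 2 (w τ) := by
  refine contDiff_iff_contDiffAt.2 fun x => ?_
  have h1 : ContDiffAt ℝ ((⊤ : ℕ∞) : WithTop ℕ∞) (fun y : E => ((τ, y) : ℝ × E)) x := by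
    fun_prop
  have h2 := hw.contDiffAt ((isOpen_Ioi.prod isOpen_univ).mem_nhds
    (show (τ, x) ∈ Set.Ioi (0 : ℝ) ×ˢ Set.univ from ⟨hτ, trivial⟩))
  exact (h2.comp x h1).of_le (by norm_cast)

theorem hasDerivAt_time (hw : ContDiffOn ℝ ((⊤ : ℕ∞) : WithTop ℕ∞) (fun p : ℝ × E => w p.1 p.2)
    (Set.Ioi 0 ×ˢ Set.univ)) {τ : ℝ} (hτ : 0 < τ) (x : E) :
    HasDerivAt (fun r => w r x) (fderiv ℝ (fun p : ℝ × E => w p.1 p.2) (τ, x) (1, 0)) τ := by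
  have h1 := hw.contDiffAt ((isOpen_Ioi.prod isOpen_univ).mem_nhds
    (show (τ, x) ∈ Set.Ioi (0 : ℝ) ×ˢ Set.univ from ⟨hτ, trivial⟩))
  have h2 : HasDerivAt (fun r : ℝ => ((r, x) : ℝ × E)) (1, 0) τ :=
    (hasDerivAt_id τ).prodMk (hasDerivAt_const τ x)
  exact (h1.differentiableAt (by simp)).hasFDerivAt.comp_hasDerivAt τ h2

end Slices

/-! ### The localized energy inequality. -/

section Deterministic

variable {E : Type*} [NormedAddCommGroup E] [InnerProductSpace ℝ E] [FiniteDimensional ℝ E]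
  [MeasurableSpace E] [BorelSpace E]

/-- A function on `(0, ∞) × E` that is continuous and vanishes outside a compact set of `E` is
integrable on `(s, t] × E` for `0 < s`. -/
theorem integrable_prod_of_continuousOn_Ioi {H : ℝ → E → ℝ} {K : Set E} (hK : IsCompact K)
    (hcont : ContinuousOn (fun p : ℝ × E => H p.1 p.2) (Set.Ioi 0 ×ˢ Set.univ))
    (hsupp : ∀ τ, ∀ x ∉ K, H τ x = 0) {s t : ℝ} (hs : 0 < s) :
    Integrable (fun p : ℝ × E => H p.1 p.2)
      (((volume : Measure ℝ).restrict (Set.Ioc s t)).prod (volume : Measure E)) := by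
  have h1 : IntegrableOn (fun p : ℝ × E => H p.1 p.2) (Set.Icc s t ×ˢ K)
      ((volume : Measure ℝ).prod (volume : Measure E)) := by
    refine ContinuousOn.integrableOn_compact (isCompact_Icc.prod hK) (hcont.mono ?_)
    rintro ⟨τ, x⟩ ⟨h1, -⟩
    exact ⟨lt_of_lt_of_le hs h1.1, trivial⟩
  rw [← Measure.restrict_univ (μ := (volume : Measure E)), Measure.prod_restrict]
  refine (h1.mono_set (s := Set.Ioc s t ×ˢ K)
    (Set.prod_mono_left Set.Ioc_subset_Icc_self)).of_forall_sdiff_eq_zero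
    (measurableSet_Ioc.prod MeasurableSet.univ) ?_
  rintro ⟨τ, x⟩ ⟨h1, h2⟩
  exact hsupp τ x fun hx => h2 ⟨h1.1, hx⟩

/-- Fubini and the fundamental theorem of calculus at each fixed `x` replace differentiation under
the integral sign. -/
theorem integral_sub_integral_eq_of_hasDerivAt {H H' : ℝ → E → ℝ} {K : Set E} (hK : IsCompact K)
    (hder : ∀ x, ∀ τ, 0 < τ → HasDerivAt (fun r => H r x) (H' τ x) τ)
    (hcont : ContinuousOn (fun p : ℝ × E => H' p.1 p.2) (Set.Ioi 0 ×ˢ Set.univ))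
    (hsupp : ∀ τ, ∀ x ∉ K, H' τ x = 0) {s t : ℝ} (hs : 0 < s) (hst : s ≤ t)
    (his : Integrable (H s)) (hit : Integrable (H t)) :
    (∫ x, H t x) - ∫ x, H s x = ∫ τ in s..t, ∫ x, H' τ x := by
  have hint := integrable_prod_of_continuousOn_Ioi hK hcont hsupp (t := t) hs
  rw [intervalIntegral.integral_of_le hst, integral_integral_swap hint, ← integral_sub hit his]
  refine integral_congr_ae (.of_forall fun x => ?_)
  simp only
  rw [← intervalIntegral.integral_of_le hst]
  have hsub : Set.uIcc s t ⊆ Set.Ioi 0 := by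
    rw [Set.uIcc_of_le hst]; exact fun r hr => lt_of_lt_of_le hs hr.1
  refine (intervalIntegral.integral_eq_sub_of_hasDerivAt (fun r hr => hder x r (hsub hr)) ?_).symm
  refine ContinuousOn.intervalIntegrable ?_
  have hc2 : ContinuousOn (fun r : ℝ => ((r, x) : ℝ × E)) (Set.uIcc s t) := by fun_prop
  exact hcont.comp hc2 fun r hr => ⟨hsub hr, trivial⟩

/-- Weighted energy inequality for `∂ₜ w = ½ Δ w + m w - N` on `[s, t]`, where `J τ` bounds the
localized dissipation `∫ (γ χ)² w N` from below. -/
theorem energy_inequality {ι : Type*} [Fintype ι] (b : OrthonormalBasis ι ℝ E)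
    {m T : ℝ} {w N : ℝ → E → ℝ}
    (hw : ContDiffOn ℝ ((⊤ : ℕ∞) : WithTop ℕ∞) (fun p : ℝ × E => w p.1 p.2)
      (Set.Ioi 0 ×ˢ Set.univ))
    (heq : ∀ t, 0 < t → ∀ x, deriv (fun s => w s x) t =
      1 / 2 * Laplacian.laplacian (fun y => w t y) x + m * w t x - N t x)
    {χ : E → ℝ} (hχ : ContDiff ℝ 1 χ) (hc : HasCompactSupport χ)
    {s t : ℝ} (hs : 0 < s) (hst : s ≤ t) (htT : t ≤ T) {J : ℝ → ℝ}
    (hJ : IntervalIntegrable J volume s t)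
    (hJN : ∀ᵐ τ ∂((volume : Measure ℝ).restrict (Set.Ioc s t)),
      J τ ≤ ∫ x, (gaussWeight m T τ x * χ x) ^ 2 * (w τ x * N τ x)) :
    (∫ x, (gaussWeight m T t x * χ x) ^ 2 * w t x ^ 2) + 2 * ∫ τ in s..t, J τ ≤
      (∫ x, (gaussWeight m T s x * χ x) ^ 2 * w s x ^ 2) +
        2 * ∫ τ in s..t, ∫ x, gaussWeight m T τ x ^ 2 *
          (w τ x ^ 2 * ∑ i, (fderiv ℝ χ x (b i)) ^ 2) := by
  have hopen : IsOpen ((Set.Ioi (0 : ℝ)) ×ˢ (Set.univ : Set E)) := isOpen_Ioi.prod isOpen_univ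
  have hslice : ∀ τ, 0 < τ → ContDiff ℝ 2 (w τ) := fun τ hτ => contDiff_slice hw hτ
  have hderiv : ∀ x, ∀ τ, 0 < τ → HasDerivAt (fun r => w r x)
      (fderiv ℝ (fun p : ℝ × E => w p.1 p.2) (τ, x) (1, 0)) τ := fun x τ hτ =>
    hasDerivAt_time hw hτ x
  have hWc : ContinuousOn (fun p : ℝ × E => w p.1 p.2) (Set.Ioi 0 ×ˢ Set.univ) := hw.continuousOn
  have hdc : ContinuousOn (fun p : ℝ × E =>
      fderiv ℝ (fun p : ℝ × E => w p.1 p.2) p (1, 0)) (Set.Ioi 0 ×ˢ Set.univ) :=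
    (hw.continuousOn_fderiv_of_isOpen hopen (by simp)).clm_apply continuousOn_const
  have hγc : Continuous fun p : ℝ × E => gaussWeight m T p.1 p.2 := continuous_gaussWeight m T
  have hγτ : ∀ τ, Continuous fun x : E => gaussWeight m T τ x := fun τ =>
    (contDiff_gaussWeight m T τ (n := 0)).continuous
  have hχc : Continuous χ := hχ.continuous
  have hχd : ∀ i, Continuous fun x => fderiv ℝ χ x (b i) := fun i =>
    (hχ.continuous_fderiv (by norm_num)).clm_apply continuous_const
  have hχ0 : ∀ x, x ∉ tsupport χ → χ x = 0 := fun x hx => image_eq_zero_of_notMem_tsupport hx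
  have hχ0' : ∀ x, x ∉ tsupport χ → fderiv ℝ χ x = 0 := fun x hx =>
    image_eq_zero_of_notMem_tsupport fun h => hx (tsupport_fderiv_subset ℝ h)
  have hcs : ∀ h : E → ℝ, (∀ x, x ∉ tsupport χ → h x = 0) → HasCompactSupport h := fun h hh =>
    HasCompactSupport.intro hc hh
  set H : ℝ → E → ℝ := fun τ x => (gaussWeight m T τ x * χ x) ^ 2 * w τ x ^ 2 with hH
  set H' : ℝ → E → ℝ := fun τ x => (gaussWeight m T τ x * χ x) ^ 2 *
    (2 * (-m - 4 * Real.exp (4 * (τ - T)) * ‖x‖ ^ 2) * w τ x ^ 2 +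
      2 * (w τ x * fderiv ℝ (fun p : ℝ × E => w p.1 p.2) (τ, x) (1, 0))) with hH'
  set G : ℝ → E → ℝ := fun τ x => gaussWeight m T τ x ^ 2 *
    (w τ x ^ 2 * ∑ i, (fderiv ℝ χ x (b i)) ^ 2) with hG
  have hHint : ∀ τ, 0 < τ → Integrable (H τ) := fun τ hτ => by
    have := (hslice τ hτ).continuous
    have := hγτ τ
    exact Continuous.integrable_of_hasCompactSupport (by fun_prop)
      (hcs _ fun x hx => by simp [hH, hχ0 x hx])
  have hHd : ∀ x, ∀ τ, 0 < τ → HasDerivAt (fun r => H r x) (H' τ x) τ := fun x τ hτ => by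
    have h1 := (((hasDerivAt_gaussWeight m T τ x).mul_const (χ x)).fun_pow 2).fun_mul
      ((hderiv x τ hτ).fun_pow 2)
    exact h1.congr_deriv (by simp only [hH']; push_cast; ring)
  have hH'c : ContinuousOn (fun p : ℝ × E => H' p.1 p.2) (Set.Ioi 0 ×ˢ Set.univ) := by
    simp only [hH']
    fun_prop
  have hGc : ContinuousOn (fun p : ℝ × E => G p.1 p.2) (Set.Ioi 0 ×ˢ Set.univ) := by
    simp only [hG]
    have : Continuous fun x => ∑ i, (fderiv ℝ χ x (b i)) ^ 2 :=
      continuous_finsetSum _ fun i _ => (hχd i).pow 2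
    have : Continuous fun p : ℝ × E => ∑ i, (fderiv ℝ χ p.2 (b i)) ^ 2 := this.comp continuous_snd
    fun_prop
  have hH's : ∀ τ, ∀ x ∉ tsupport χ, H' τ x = 0 := fun τ x hx => by simp [hH', hχ0 x hx]
  have hGs : ∀ τ, ∀ x ∉ tsupport χ, G τ x = 0 := fun τ x hx => by simp [hG, hχ0' x hx]
  have hmain := integral_sub_integral_eq_of_hasDerivAt hc hHd hH'c hH's hs hst
    (hHint s hs) (hHint t (hs.trans_le hst))
  have hH'i := integrable_prod_of_continuousOn_Ioi hc hH'c hH's (t := t) hs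
  have hGi := integrable_prod_of_continuousOn_Ioi hc hGc hGs (t := t) hs
  have hGii : IntervalIntegrable (fun τ => ∫ x, G τ x) volume s t := by
    rw [intervalIntegrable_iff_integrableOn_Ioc_of_le hst]
    exact hGi.integral_prod_left
  have hpt : ∀ τ, s < τ → τ ≤ t → ∫ x, H' τ x ≤
      2 * (∫ x, G τ x) - 2 * ∫ x, (gaussWeight m T τ x * χ x) ^ 2 * (w τ x * N τ x) := by
    intro τ hsτ hτt
    have hτ : 0 < τ := hs.trans hsτ
    have hψ : ContDiff ℝ 1 fun x => gaussWeight m T τ x * χ x :=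
      (contDiff_gaussWeight m T τ).mul hχ
    have hψc : HasCompactSupport fun x => gaussWeight m T τ x * χ x :=
      hcs _ fun x hx => by simp [hχ0 x hx]
    have hgreen := integral_sq_mul_mul_laplacian_le b (hslice τ hτ) hψ hψc
    have hwc := (hslice τ hτ).continuous
    have hgc := hγτ τ
    have hD : ∀ x, fderiv ℝ (fun p : ℝ × E => w p.1 p.2) (τ, x) (1, 0) =
        1 / 2 * Laplacian.laplacian (w τ) x + m * w τ x - N τ x := fun x => by
      rw [← (hderiv x τ hτ).deriv, heq τ hτ x]
    have hlapc : Continuous (Laplacian.laplacian (w τ)) := by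
      have h2 : Continuous (iteratedFDeriv ℝ 2 (w τ)) :=
        (hslice τ hτ).continuous_iteratedFDeriv le_rfl
      rw [InnerProductSpace.laplacian_eq_iteratedFDeriv_orthonormalBasis (w τ) b]
      exact continuous_finsetSum _ fun i _ =>
        (ContinuousMultilinearMap.apply ℝ (fun _ : Fin 2 => E) ℝ ![b i, b i]).continuous.comp h2
    have hdcx : Continuous fun x => fderiv ℝ (fun p : ℝ × E => w p.1 p.2) (τ, x) (1, 0) := by
      have hc2 : Continuous (fun x : E => ((τ, x) : ℝ × E)) := by fun_prop
      exact hdc.comp_continuous hc2 fun x => ⟨hτ, trivial⟩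
    -- No regularity of `N` is assumed: the equation expresses it through derivatives of `w`.
    have hNc : Continuous (N τ) := by
      have : N τ = fun x => 1 / 2 * Laplacian.laplacian (w τ) x + m * w τ x -
          fderiv ℝ (fun p : ℝ × E => w p.1 p.2) (τ, x) (1, 0) := by
        ext x; rw [hD]; ring
      rw [this]; fun_prop
    have hsumc : Continuous fun x =>
        ∑ i, (fderiv ℝ (fun y => gaussWeight m T τ y * χ y) x (b i)) ^ 2 :=
      continuous_finsetSum _ fun i _ =>
        ((hψ.continuous_fderiv (by norm_num)).clm_apply continuous_const).pow 2
    have hsum0 : ∀ x, x ∉ tsupport χ →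
        ∑ i, (fderiv ℝ (fun y => gaussWeight m T τ y * χ y) x (b i)) ^ 2 = 0 := fun x hx => by
      have hle := sum_fderiv_gaussWeight_mul_sq_le b m (hτt.trans htT)
        (hχ.differentiable (by norm_num)) x
      simp only [hχ0 x hx, hχ0' x hx] at hle
      refine le_antisymm (by simpa using hle) (Finset.sum_nonneg fun i _ => sq_nonneg _)
    have hI1 : Integrable fun x => (gaussWeight m T τ x * χ x) ^ 2 *
        (w τ x * Laplacian.laplacian (w τ) x) :=
      Continuous.integrable_of_hasCompactSupport (by fun_prop)
        (hcs _ fun x hx => by simp [hχ0 x hx])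
    have hI2 : Integrable fun x => w τ x ^ 2 *
        ∑ i, (fderiv ℝ (fun y => gaussWeight m T τ y * χ y) x (b i)) ^ 2 :=
      Continuous.integrable_of_hasCompactSupport (by fun_prop)
        (hcs _ fun x hx => by rw [hsum0 x hx, mul_zero])
    have hI3 : Integrable fun x => (gaussWeight m T τ x * χ x) ^ 2 * (w τ x * N τ x) :=
      Continuous.integrable_of_hasCompactSupport (by fun_prop)
        (hcs _ fun x hx => by simp [hχ0 x hx])
    have hI4 : Integrable fun x => (gaussWeight m T τ x * χ x) ^ 2 *
        (8 * Real.exp (4 * (τ - T)) * ‖x‖ ^ 2 * w τ x ^ 2) :=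
      Continuous.integrable_of_hasCompactSupport (by fun_prop)
        (hcs _ fun x hx => by simp [hχ0 x hx])
    have hI5 : Integrable (G τ) := by
      refine Continuous.integrable_of_hasCompactSupport ?_ (hcs _ (hGs τ))
      have : Continuous fun x => ∑ i, (fderiv ℝ χ x (b i)) ^ 2 :=
        continuous_finsetSum _ fun i _ => (hχd i).pow 2
      simp only [hG]
      fun_prop
    -- The `-2m` coming from the weight cancels the `2m` coming from the reaction term.
    have hsplit : ∫ x, H' τ x = (∫ x, (gaussWeight m T τ x * χ x) ^ 2 *
        (w τ x * Laplacian.laplacian (w τ) x)) -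
        (∫ x, (gaussWeight m T τ x * χ x) ^ 2 *
          (8 * Real.exp (4 * (τ - T)) * ‖x‖ ^ 2 * w τ x ^ 2)) -
        2 * ∫ x, (gaussWeight m T τ x * χ x) ^ 2 * (w τ x * N τ x) := by
      have e1 := integral_sub (hI1.sub hI4) (hI3.const_mul 2)
      simp only [Pi.sub_apply] at e1
      rw [integral_sub hI1 hI4, integral_const_mul] at e1
      rw [← e1]
      refine integral_congr_ae (.of_forall fun x => ?_)
      simp only [hH', hD]; ring
    have hgrad : ∫ x, w τ x ^ 2 *
        ∑ i, (fderiv ℝ (fun y => gaussWeight m T τ y * χ y) x (b i)) ^ 2 ≤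
        (∫ x, (gaussWeight m T τ x * χ x) ^ 2 *
          (8 * Real.exp (4 * (τ - T)) * ‖x‖ ^ 2 * w τ x ^ 2)) + 2 * ∫ x, G τ x := by
      rw [← integral_const_mul, ← integral_add hI4 (hI5.const_mul 2)]
      refine integral_mono hI2 (hI4.add (hI5.const_mul 2)) fun x => ?_
      have hle := sum_fderiv_gaussWeight_mul_sq_le b m (hτt.trans htT)
        (hχ.differentiable (by norm_num)) x
      refine (mul_le_mul_of_nonneg_left hle (sq_nonneg (w τ x))).trans_eq ?_
      simp only [hG]; ring
    -- The terms with `8 g |x|²` in `hsplit` and `hgrad` cancel.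
    linarith
  have hle : ∫ τ in s..t, ∫ x, H' τ x ≤ ∫ τ in s..t, (2 * (∫ x, G τ x) - 2 * J τ) := by
    rw [intervalIntegral.integral_of_le hst, intervalIntegral.integral_of_le hst]
    refine integral_mono_ae ?_ ?_ ?_
    · exact hH'i.integral_prod_left
    · exact ((hGii.const_mul 2).sub (hJ.const_mul 2)).1
    · filter_upwards [hJN, ae_restrict_mem measurableSet_Ioc] with τ h1 h2
      have := hpt τ h2.1 h2.2
      linarith
  rw [intervalIntegral.integral_sub (hGii.const_mul 2) (hJ.const_mul 2),
    intervalIntegral.integral_const_mul, intervalIntegral.integral_const_mul] at hle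
  linarith

end Deterministic

/-! ### Joint measurability, and Gaussian decay against exponential growth. -/

/-- A random field that is measurable at every point and almost surely continuous is jointly
almost everywhere strongly measurable. -/
theorem aestronglyMeasurable_prod_of_ae_continuous {Ω ι : Type*} [MeasurableSpace Ω]
    {P : Measure Ω} [TopologicalSpace ι] [TopologicalSpace.MetrizableSpace ι]
    [SecondCountableTopology ι] [MeasurableSpace ι] [BorelSpace ι] (μ : Measure ι) [SFinite P]
    [SFinite μ] {u : Ω → ι → ℝ} (hmeas : ∀ i, AEStronglyMeasurable (fun ω => u ω i) P)
    (hcont : ∀ᵐ ω ∂P, Continuous (u ω)) :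
    AEStronglyMeasurable (fun p : Ω × ι => u p.1 p.2) (P.prod μ) := by
  obtain ⟨D, hDc, hDd⟩ := TopologicalSpace.exists_countable_dense ι
  have hae : ∀ᵐ ω ∂P, Continuous (u ω) ∧ ∀ d ∈ D, u ω d = (hmeas d).mk _ ω :=
    hcont.and ((ae_ball_iff hDc).2 fun d _ => (hmeas d).ae_eq_mk)
  -- The exceptional set is enlarged to a measurable null set, off which paths are continuous and
  -- agree with measurable versions on a countable dense set. Zeroing the field on it gives a
  -- Carathéodory function.
  obtain ⟨S, hSsub, hSmeas, hSnull⟩ := exists_measurable_superset_of_null (ae_iff.1 hae)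
  have hgood : ∀ ω ∉ S, Continuous (u ω) ∧ ∀ d ∈ D, u ω d = (hmeas d).mk _ ω := fun ω hω => by
    by_contra h; exact hω (hSsub h)
  set u' : ι → Ω → ℝ := fun i => Sᶜ.indicator fun ω => u ω i with hu'
  have hu'c : ∀ ω, Continuous fun i => u' i ω := fun ω => by
    by_cases h : ω ∈ S
    · simp [hu', h, continuous_const]
    · simpa [hu', h] using (hgood ω h).1
  have hu'D : ∀ d ∈ D, StronglyMeasurable (u' d) := fun d hd => by
    have : u' d = Sᶜ.indicator ((hmeas d).mk _) := by
      ext ω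
      by_cases h : ω ∈ S
      · simp [hu', h]
      · simp [hu', h, (hgood ω h).2 d hd]
    rw [this]
    exact (hmeas d).stronglyMeasurable_mk.indicator hSmeas.compl
  have hu'm : ∀ i, StronglyMeasurable (u' i) := fun i => by
    obtain ⟨x, hx, hlim⟩ := mem_closure_iff_seq_limit.1 (hDd i)
    refine stronglyMeasurable_of_tendsto atTop (fun n => hu'D (x n) (hx n)) ?_
    exact tendsto_pi_nhds.2 fun ω => ((hu'c ω).tendsto i).comp hlim
  have hjoint := stronglyMeasurable_uncurry_of_continuous_of_stronglyMeasurable hu'c hu'm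
  refine ⟨fun p => u' p.2 p.1, hjoint.comp_measurable measurable_swap, ?_⟩
  have hS : ∀ᵐ ω ∂P, ω ∉ S := measure_eq_zero_iff_ae_notMem.1 hSnull
  filter_upwards [Measure.quasiMeasurePreserving_fst.ae hS] with p hp
  simp [hu', hp]

theorem tendsto_const_div_add_one_sq (K : ℝ) :
    Tendsto (fun n : ℕ => K / ((n : ℝ) + 1) ^ 2) atTop (𝓝 0) := by
  refine tendsto_const_nhds.div_atTop ?_
  exact (tendsto_pow_atTop two_ne_zero).comp
    (tendsto_atTop_add_const_right _ 1 tendsto_natCast_atTop_atTop)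

/-- On `[0, T]` the rate in `γ²` is at least `2δ` with `δ = e^{-4T}`; half of it absorbs the
exponential through `2 r |x| ≤ δ |x|² + r²/δ`. -/
theorem gaussWeight_sq_mul_le (m : ℝ) {T τ : ℝ} (h0 : 0 ≤ τ) (hT : τ ≤ T) (r : ℝ) {E : Type*}
    [NormedAddCommGroup E] (x : E) :
    gaussWeight m T τ x ^ 2 * Real.exp (r * ‖x‖) ^ 2 ≤
      Real.exp (2 * |m| * T + r ^ 2 / Real.exp (-4 * T)) *
        Real.exp (-Real.exp (-4 * T) * ‖x‖ ^ 2) := by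
  rw [gaussWeight, ← Real.exp_nat_mul, ← Real.exp_nat_mul, ← Real.exp_add, ← Real.exp_add]
  refine Real.exp_le_exp.2 ?_
  set δ := Real.exp (-4 * T) with hδ
  have hδ0 : 0 < δ := Real.exp_pos _
  have hg : δ ≤ Real.exp (4 * (τ - T)) := Real.exp_le_exp.2 (by linarith)
  have h1 : -m * τ ≤ |m| * T :=
    mul_le_mul (neg_le_abs m) hT h0 (abs_nonneg m)
  have h2 : 2 * (r * ‖x‖) ≤ δ * ‖x‖ ^ 2 + r ^ 2 / δ := by
    have h3 : δ * ‖x‖ ^ 2 + r ^ 2 / δ - 2 * (r * ‖x‖) = (δ * ‖x‖ - r) ^ 2 / δ := by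
      field_simp; ring
    have h4 : 0 ≤ (δ * ‖x‖ - r) ^ 2 / δ := by positivity
    linarith
  have h5 : δ * ‖x‖ ^ 2 ≤ Real.exp (4 * (τ - T)) * ‖x‖ ^ 2 := by gcongr
  push_cast
  nlinarith

theorem continuous_slice {E : Type*} [TopologicalSpace E] {w : ℝ → E → ℝ}
    (hw : ContinuousOn (fun p : ℝ × E => w p.1 p.2) (Set.Ioi 0 ×ˢ Set.univ)) {τ : ℝ}
    (hτ : 0 < τ) : Continuous (w τ) := by
  have hc2 : Continuous (fun x : E => ((τ, x) : ℝ × E)) := by fun_prop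
  exact hw.comp_continuous hc2 fun x => ⟨hτ, trivial⟩

/-! ### Cutoffs and pathwise energy bounds. -/

section Deterministic

variable {E : Type*} [NormedAddCommGroup E] [InnerProductSpace ℝ E] [FiniteDimensional ℝ E]

/-- Dilates of a single bump function: scaling by `n + 1` divides the gradient by `n + 1`. -/
theorem exists_cutoff {ι : Type*} [Fintype ι] (b : OrthonormalBasis ι ℝ E) :
    ∃ (χ : ℕ → E → ℝ) (K : ℝ), 0 ≤ K ∧ ∀ n, ContDiff ℝ 1 (χ n) ∧ HasCompactSupport (χ n) ∧
      (∀ x, 0 ≤ χ n x) ∧ (∀ x, χ n x ≤ 1) ∧ (∀ x, ‖x‖ ≤ n → χ n x = 1) ∧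
      ∀ x, ∑ i, (fderiv ℝ (χ n) x (b i)) ^ 2 ≤ K / (n + 1) ^ 2 := by
  let f : ContDiffBump (0 : E) := ⟨1, 2, one_pos, one_lt_two⟩
  have hf : ContDiff ℝ 1 f := f.contDiff
  have hcont : Continuous fun x => ∑ i, (fderiv ℝ f x (b i)) ^ 2 :=
    continuous_finsetSum _ fun i _ =>
      ((hf.continuous_fderiv (by norm_num)).clm_apply continuous_const).pow 2
  have hsupp : HasCompactSupport fun x => ∑ i, (fderiv ℝ f x (b i)) ^ 2 := by
    refine HasCompactSupport.intro f.hasCompactSupport fun x hx => ?_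
    have : fderiv ℝ f x = 0 :=
      image_eq_zero_of_notMem_tsupport fun h => hx (tsupport_fderiv_subset ℝ h)
    simp [this]
  obtain ⟨K, hK⟩ := hsupp.exists_bound_of_continuous hcont
  refine ⟨fun n x => f ((1 / ((n : ℝ) + 1)) • x), K, (norm_nonneg _).trans (hK 0), fun n => ?_⟩
  have hn : (0 : ℝ) < n + 1 := by positivity
  set c : ℝ := 1 / ((n : ℝ) + 1) with hc
  have hc0 : 0 < c := by positivity
  refine ⟨hf.comp (contDiff_const_smul c), ?_, fun x => f.nonneg, fun x => f.le_one,
    fun x hx => ?_, fun x => ?_⟩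
  · exact f.hasCompactSupport.comp_homeomorph (Homeomorph.smulOfNeZero c hc0.ne')
  · refine f.one_of_mem_closedBall ?_
    rw [mem_closedBall_zero_iff, norm_smul, Real.norm_of_nonneg hc0.le, hc, one_div_mul_eq_div]
    exact (div_le_one hn).2 (by linarith)
  · have h1 : fderiv ℝ (fun x => f (c • x)) x = c • fderiv ℝ f (c • x) := by
      rw [fderiv_comp_smul]
    have h2 := (le_abs_self _).trans (hK (c • x))
    calc ∑ i, (fderiv ℝ (fun x => f (c • x)) x (b i)) ^ 2
        = c ^ 2 * ∑ i, (fderiv ℝ f (c • x) (b i)) ^ 2 := by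
          simp only [h1, smul_apply, smul_eq_mul, mul_pow, ← Finset.mul_sum]
      _ ≤ c ^ 2 * K := by gcongr
      _ = K / (n + 1) ^ 2 := by rw [hc]; field_simp

variable [MeasurableSpace E] [BorelSpace E]

theorem integrable_exp_neg_mul_norm_sq {δ : ℝ} (hδ : 0 < δ) :
    Integrable fun x : E => Real.exp (-δ * ‖x‖ ^ 2) := by
  have h := (GaussianFourier.integrable_cexp_neg_mul_sq_norm_add (V := E) (b := (δ : ℂ))
    (by simpa using hδ) 0 0).norm
  refine h.congr (.of_forall fun x => ?_)
  simp [Complex.norm_exp, ← Complex.ofReal_pow]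

/-- Domination of the weighted square of a function of exponential growth, uniformly in time. -/
theorem exists_integrable_dominating (m T : ℝ) (M r : ℝ) :
    ∃ g : E → ℝ, Integrable g ∧ ∀ τ, 0 ≤ τ → τ ≤ T → ∀ (x : E) (y : ℝ),
      |y| ≤ M * Real.exp (r * ‖x‖) → gaussWeight m T τ x ^ 2 * y ^ 2 ≤ g x := by
  refine ⟨_, (integrable_exp_neg_mul_norm_sq (E := E) (Real.exp_pos (-4 * T))).const_mul
    (M ^ 2 * Real.exp (2 * |m| * T + r ^ 2 / Real.exp (-4 * T))), fun τ h0 hT x y hy => ?_⟩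
  have h1 : y ^ 2 ≤ M ^ 2 * Real.exp (r * ‖x‖) ^ 2 := by
    rw [← mul_pow, ← sq_abs y]
    exact pow_le_pow_left₀ (abs_nonneg y) hy 2
  calc gaussWeight m T τ x ^ 2 * y ^ 2
      ≤ gaussWeight m T τ x ^ 2 * (M ^ 2 * Real.exp (r * ‖x‖) ^ 2) := by gcongr
    _ = M ^ 2 * (gaussWeight m T τ x ^ 2 * Real.exp (r * ‖x‖) ^ 2) := by ring
    _ ≤ M ^ 2 * (Real.exp (2 * |m| * T + r ^ 2 / Real.exp (-4 * T)) *
        Real.exp (-Real.exp (-4 * T) * ‖x‖ ^ 2)) := by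
      exact mul_le_mul_of_nonneg_left (gaussWeight_sq_mul_le m h0 hT r x) (sq_nonneg M)
    _ = _ := by ring

theorem integrable_gaussWeight_sq_mul_sq {m T M r τ : ℝ} (h0 : 0 ≤ τ) (hT : τ ≤ T) {f : E → ℝ}
    (hf : AEStronglyMeasurable f) (hg : ∀ x, |f x| ≤ M * Real.exp (r * ‖x‖)) :
    Integrable fun x => gaussWeight m T τ x ^ 2 * f x ^ 2 := by
  obtain ⟨g, hgi, hgb⟩ := exists_integrable_dominating (E := E) m T M r
  refine hgi.mono' (((contDiff_gaussWeight m T τ (n := 0)).continuous.pow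
    2).aestronglyMeasurable.mul (hf.pow 2)) (.of_forall fun x => ?_)
  rw [Real.norm_of_nonneg (by positivity)]
  exact hgb τ h0 hT x _ (hg x)

/-- The energy inequality with the gradient of the cutoff estimated by an a priori energy bound. -/
theorem energy_inequality_of_bound {ι : Type*} [Fintype ι] (b : OrthonormalBasis ι ℝ E)
    {m T M r : ℝ} {w N : ℝ → E → ℝ}
    (hw : ContDiffOn ℝ ((⊤ : ℕ∞) : WithTop ℕ∞) (fun p : ℝ × E => w p.1 p.2)
      (Set.Ioi 0 ×ˢ Set.univ))
    (heq : ∀ t, 0 < t → ∀ x, deriv (fun s => w s x) t =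
      1 / 2 * Laplacian.laplacian (fun y => w t y) x + m * w t x - N t x)
    (hg : ∀ τ, 0 ≤ τ → τ ≤ T → ∀ x, |w τ x| ≤ M * Real.exp (r * ‖x‖))
    {χ : E → ℝ} (hχ : ContDiff ℝ 1 χ) (hc : HasCompactSupport χ) (hχ0 : ∀ x, 0 ≤ χ x)
    (hχ1 : ∀ x, χ x ≤ 1) {L : ℝ} (hL0 : 0 ≤ L)
    (hL : ∀ x, ∑ i, (fderiv ℝ χ x (b i)) ^ 2 ≤ L)
    {s t : ℝ} (hs : 0 < s) (hst : s ≤ t) (htT : t ≤ T) {A : ℝ}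
    (hA : ∀ τ, 0 < τ → τ ≤ T → ∫ x, gaussWeight m T τ x ^ 2 * w τ x ^ 2 ≤ A) {J : ℝ → ℝ}
    (hJ : IntervalIntegrable J volume s t)
    (hJN : ∀ᵐ τ ∂((volume : Measure ℝ).restrict (Set.Ioc s t)),
      J τ ≤ ∫ x, (gaussWeight m T τ x * χ x) ^ 2 * (w τ x * N τ x)) :
    (∫ x, (gaussWeight m T t x * χ x) ^ 2 * w t x ^ 2) + 2 * ∫ τ in s..t, J τ ≤
      (∫ x, gaussWeight m T s x ^ 2 * w s x ^ 2) + 2 * T * L * A := by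
  have hint : ∀ τ, 0 < τ → τ ≤ T →
      Integrable fun x => gaussWeight m T τ x ^ 2 * w τ x ^ 2 := fun τ h0 hT =>
    integrable_gaussWeight_sq_mul_sq h0.le hT
      (continuous_slice hw.continuousOn h0).aestronglyMeasurable (hg τ h0.le hT)
  have hsT := hst.trans htT
  have hA0 : 0 ≤ A := le_trans (integral_nonneg fun x => by positivity) (hA s hs hsT)
  have h := energy_inequality b hw heq hχ hc hs hst htT hJ hJN
  have h1 : ∫ x, (gaussWeight m T s x * χ x) ^ 2 * w s x ^ 2 ≤
      ∫ x, gaussWeight m T s x ^ 2 * w s x ^ 2 := by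
    refine integral_mono_of_nonneg (.of_forall fun x => by positivity) (hint s hs hsT)
      (.of_forall fun x => ?_)
    have : χ x ^ 2 ≤ 1 := pow_le_one₀ (hχ0 x) (hχ1 x)
    simp only [mul_pow]
    have h2 : 0 ≤ gaussWeight m T s x ^ 2 * w s x ^ 2 := by positivity
    nlinarith
  have h2 : ∫ τ in s..t, ∫ x, gaussWeight m T τ x ^ 2 *
      (w τ x ^ 2 * ∑ i, (fderiv ℝ χ x (b i)) ^ 2) ≤ L * A * |t - s| := by
    refine (Real.le_norm_self _).trans (intervalIntegral.norm_integral_le_of_norm_le_const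
      fun τ hτ => ?_)
    rw [Set.uIoc_of_le hst] at hτ
    have hτ0 := hs.trans hτ.1
    have hτT := hτ.2.trans htT
    rw [Real.norm_of_nonneg (integral_nonneg fun x => by positivity)]
    calc _ ≤ ∫ x, L * (gaussWeight m T τ x ^ 2 * w τ x ^ 2) := by
          refine integral_mono_of_nonneg (.of_forall fun x => by positivity)
            ((hint τ hτ0 hτT).const_mul L) (.of_forall fun x => ?_)
          simp only
          rw [← mul_assoc, mul_comm L]
          gcongr
          exact hL x
      _ ≤ L * A := by
          rw [integral_const_mul]
          gcongr
          exact hA τ hτ0 hτT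
  rw [abs_of_nonneg (by linarith)] at h2
  have h3 : L * A * (t - s) ≤ L * A * T := by gcongr; linarith
  linarith

theorem tendsto_integral_cutoff {χ : ℕ → E → ℝ} (hχc : ∀ n, Continuous (χ n))
    (hχ0 : ∀ n x, 0 ≤ χ n x) (hχ1 : ∀ n x, χ n x ≤ 1)
    (hχ : ∀ (n : ℕ) x, ‖x‖ ≤ n → χ n x = 1) {m T t : ℝ} {f : E → ℝ} (hf : Continuous f)
    (hi : Integrable fun x => gaussWeight m T t x ^ 2 * f x ^ 2) :
    Tendsto (fun n => ∫ x, (gaussWeight m T t x * χ n x) ^ 2 * f x ^ 2) atTop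
      (𝓝 (∫ x, gaussWeight m T t x ^ 2 * f x ^ 2)) := by
  have hγ : Continuous (gaussWeight m T t : E → ℝ) :=
    (contDiff_gaussWeight m T t (n := 0)).continuous
  refine tendsto_integral_of_dominated_convergence _ (fun n => ?_) hi
    (fun n => .of_forall fun x => ?_) (.of_forall fun x => ?_)
  · have := hχc n
    exact Continuous.aestronglyMeasurable (by fun_prop)
  · rw [Real.norm_of_nonneg (by positivity), mul_pow]
    have h1 : χ n x ^ 2 ≤ 1 := pow_le_one₀ (hχ0 n x) (hχ1 n x)
    have h2 : 0 ≤ gaussWeight m T t x ^ 2 * f x ^ 2 := by positivity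
    nlinarith
  · refine tendsto_const_nhds.congr' ?_
    obtain ⟨k, hk⟩ := exists_nat_ge ‖x‖
    filter_upwards [eventually_ge_atTop k] with n hn
    rw [hχ n x (hk.trans (by exact_mod_cast hn)), mul_one]

/-- The weighted energy is continuous at time `0` along a path attaining its initial value. -/
theorem tendsto_energy_initial {m T M r : ℝ} (hT : 0 < T) {w : ℝ → E → ℝ} {w₀ : E → ℝ}
    (hw : ContinuousOn (fun p : ℝ × E => w p.1 p.2) (Set.Ioi 0 ×ˢ Set.univ))
    (hg : ∀ τ, 0 ≤ τ → τ ≤ T → ∀ x, |w τ x| ≤ M * Real.exp (r * ‖x‖))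
    (h0 : ∀ᵐ x, Tendsto (fun t => w t x) (𝓝[>] 0) (𝓝 (w₀ x))) :
    Tendsto (fun s => ∫ x, gaussWeight m T s x ^ 2 * w s x ^ 2) (𝓝[>] 0)
      (𝓝 (∫ x, gaussWeight m T 0 x ^ 2 * w₀ x ^ 2)) := by
  obtain ⟨g, hgi, hgb⟩ := exists_integrable_dominating (E := E) m T M r
  have hev : ∀ᶠ s in 𝓝[>] (0 : ℝ), s ∈ Set.Ioc 0 T := Ioc_mem_nhdsGT hT
  refine tendsto_integral_filter_of_dominated_convergence g ?_ ?_ hgi ?_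
  · filter_upwards [hev] with s hs
    have := continuous_slice hw hs.1
    have : Continuous (gaussWeight m T s : E → ℝ) :=
      (contDiff_gaussWeight m T s (n := 0)).continuous
    exact Continuous.aestronglyMeasurable (by fun_prop)
  · filter_upwards [hev] with s hs
    refine .of_forall fun x => ?_
    rw [Real.norm_of_nonneg (by positivity)]
    exact hgb s hs.1.le hs.2 x _ (hg s hs.1.le hs.2 x)
  · filter_upwards [h0] with x hx
    have hγ : Tendsto (fun s => gaussWeight m T s x) (𝓝[>] 0) (𝓝 (gaussWeight m T 0 x)) :=
      (hasDerivAt_gaussWeight m T 0 x).continuousAt.tendsto.mono_left nhdsWithin_le_nhds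
    exact (hγ.pow 2).mul (hx.pow 2)

/-- With a dissipative nonlinearity the weighted energy is bounded by its initial value. -/
theorem energy_le_initial {ι : Type*} [Fintype ι] (b : OrthonormalBasis ι ℝ E)
    {m T M r : ℝ} {w N : ℝ → E → ℝ} {w₀ : E → ℝ}
    (hw : ContDiffOn ℝ ((⊤ : ℕ∞) : WithTop ℕ∞) (fun p : ℝ × E => w p.1 p.2)
      (Set.Ioi 0 ×ˢ Set.univ))
    (heq : ∀ t, 0 < t → ∀ x, deriv (fun s => w s x) t =
      1 / 2 * Laplacian.laplacian (fun y => w t y) x + m * w t x - N t x)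
    (hN : ∀ t, 0 < t → ∀ x, 0 ≤ w t x * N t x)
    (hg : ∀ τ, 0 ≤ τ → τ ≤ T → ∀ x, |w τ x| ≤ M * Real.exp (r * ‖x‖))
    (h0 : ∀ᵐ x, Tendsto (fun t => w t x) (𝓝[>] 0) (𝓝 (w₀ x))) {t : ℝ} (ht : 0 < t)
    (htT : t ≤ T) :
    ∫ x, gaussWeight m T t x ^ 2 * w t x ^ 2 ≤ ∫ x, gaussWeight m T 0 x ^ 2 * w₀ x ^ 2 := by
  obtain ⟨χ, K, hK, hχ⟩ := exists_cutoff b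
  obtain ⟨g, hgi, hgb⟩ := exists_integrable_dominating (E := E) m T M r
  -- This crude bound depends on the growth constants of the path; it only serves to make the cutoff
  -- error vanish as `n → ∞`.
  have hA : ∀ τ, 0 < τ → τ ≤ T → ∫ x, gaussWeight m T τ x ^ 2 * w τ x ^ 2 ≤ ∫ x, g x :=
    fun τ hτ hτT => integral_mono_of_nonneg (.of_forall fun x => by positivity) hgi
      (.of_forall fun x => hgb τ hτ.le hτT x _ (hg τ hτ.le hτT x))
  have hstep : ∀ s, 0 < s → s ≤ t → ∫ x, gaussWeight m T t x ^ 2 * w t x ^ 2 ≤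
      ∫ x, gaussWeight m T s x ^ 2 * w s x ^ 2 := by
    intro s hs hst
    have hn : ∀ n : ℕ, ∫ x, (gaussWeight m T t x * χ n x) ^ 2 * w t x ^ 2 ≤
        (∫ x, gaussWeight m T s x ^ 2 * w s x ^ 2) +
          2 * T * (K / ((n : ℝ) + 1) ^ 2) * ∫ x, g x := by
      intro n
      obtain ⟨h1, h2, h3, h4, -, h6⟩ := hχ n
      -- The nonlinear term is nonnegative, so `J = 0` is a lower bound and its integrability in
      -- time is never needed.
      have h := energy_inequality_of_bound b hw heq hg h1 h2 h3 h4 (by positivity) h6 hs hst htT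
        hA (J := fun _ => 0) (by simp) ?_
      · simpa using h
      filter_upwards [ae_restrict_mem measurableSet_Ioc] with τ hτ
      exact integral_nonneg fun x => mul_nonneg (by positivity) (hN τ (hs.trans hτ.1) x)
    have hwt := continuous_slice hw.continuousOn ht
    refine le_of_tendsto_of_tendsto' (tendsto_integral_cutoff (fun n => (hχ n).1.continuous)
      (fun n => (hχ n).2.2.1) (fun n => (hχ n).2.2.2.1) (fun n => (hχ n).2.2.2.2.1) hwt
      (integrable_gaussWeight_sq_mul_sq ht.le htT hwt.aestronglyMeasurable
        (hg t ht.le htT))) ?_ hn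
    have hlim := tendsto_const_div_add_one_sq K
    simpa using ((hlim.const_mul (2 * T)).mul_const (∫ x, g x)).const_add
      (∫ x, gaussWeight m T s x ^ 2 * w s x ^ 2)
  refine ge_of_tendsto (tendsto_energy_initial (ht.trans_le htT) hw.continuousOn hg h0) ?_
  filter_upwards [Ioc_mem_nhdsGT ht] with s hs
  exact hstep s hs.1 hs.2

end Deterministic

/-! ### Monotonicity of the mean field and almost sure bounds for solutions. -/

theorem SupInExpGrowth.exists_bound {T : ℝ} {g : ℝ → Plane → ℝ} (h : SupInExpGrowth T g) :
    ∃ M r : ℝ, 0 ≤ M ∧ ∀ τ, 0 ≤ τ → τ ≤ T → ∀ x, g τ x ≤ M * Real.exp (r * ‖x‖) := by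
  obtain ⟨f, ⟨r, -, B, hB⟩, hf⟩ := h
  refine ⟨|B|, r, abs_nonneg B, fun τ h0 hT x => ?_⟩
  have h1 : g τ x ≤ f x := (hf x).1 ⟨τ, ⟨h0, hT⟩, rfl⟩
  have h2 : |f x| * Real.exp (-r * ‖x‖) ≤ B := hB ⟨x, rfl⟩
  have h3 : |f x| = |f x| * Real.exp (-r * ‖x‖) * Real.exp (r * ‖x‖) := by
    rw [mul_assoc, ← Real.exp_add]; simp
  calc g τ x ≤ |f x| := h1.trans (le_abs_self _)
    _ ≤ |B| * Real.exp (r * ‖x‖) := by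
      rw [h3]; gcongr; exact h2.trans (le_abs_self B)

/-- Monotonicity of the mean-field nonlinearity `X ↦ 𝔼[X²] X`. -/
theorem integral_sub_mul_meanField_nonneg {Ω : Type*} [MeasurableSpace Ω] {P : Measure Ω}
    {X Y : Ω → ℝ} (hX : MemLp X 2 P) (hY : MemLp Y 2 P) :
    0 ≤ ∫ ω, (X ω - Y ω) * ((∫ ω', X ω' ^ 2 ∂P) * X ω - (∫ ω', Y ω' ^ 2 ∂P) * Y ω) ∂P := by
  set a := ∫ ω', X ω' ^ 2 ∂P with ha
  set b := ∫ ω', Y ω' ^ 2 ∂P with hb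
  have ha0 : 0 ≤ a := integral_nonneg fun _ => sq_nonneg _
  have hb0 : 0 ≤ b := integral_nonneg fun _ => sq_nonneg _
  have hX2 := hX.integrable_sq
  have hY2 := hY.integrable_sq
  have hint : Integrable (fun ω => (X ω - Y ω) * (a * X ω - b * Y ω)) P :=
    (hX.sub hY).integrable_mul ((hX.const_mul a).sub (hY.const_mul b))
  -- From `(X - Y)(aX - bY) = (a + b)/2 (X - Y)² + (a - b)/2 (X² - Y²)`, dropping the first square.
  -- The expectation of the rest is `(a - b)²/2`.
  have hle : ∫ ω, (a - b) / 2 * (X ω ^ 2 - Y ω ^ 2) ∂P ≤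
      ∫ ω, (X ω - Y ω) * (a * X ω - b * Y ω) ∂P := by
    refine integral_mono ((hX2.sub hY2).const_mul _) hint fun ω => ?_
    simp only
    nlinarith [mul_nonneg (add_nonneg ha0 hb0) (sq_nonneg (X ω - Y ω))]
  rw [integral_const_mul, integral_sub hX2 hY2, ← ha, ← hb] at hle
  nlinarith [sq_nonneg (a - b)]

section Probability

variable {Ω : Type*} [MeasurableSpace Ω] {P : Measure Ω} {m α : ℝ}
  {v₀ : Ω → Plane → ℝ} {u v : Ω → ℝ → Plane → ℝ}

/-- Along almost every path the energy of a solution is bounded by its initial value. -/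
theorem IsSolution.ae_energy_le (hα : 0 < α) (hv : IsSolution P m α v₀ v) {T : ℝ} (hT : 0 < T) :
    ∀ᵐ ω ∂P, ∀ t, 0 < t → t ≤ T → ∫ x, gaussWeight m T t x ^ 2 * v ω t x ^ 2 ≤
      ∫ x, gaussWeight m T 0 x ^ 2 * v₀ ω x ^ 2 := by
  filter_upwards [hv.smooth, hv.equation, hv.tendsto_initial, hv.growth T hT] with ω h1 h2 h3 h4
  obtain ⟨M, r, -, hg⟩ := h4.exists_bound
  intro t ht htT
  refine energy_le_initial (EuclideanSpace.basisFun (Fin 2) ℝ) h1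
    (N := fun t x => α * (∫ ω', (v ω' t x) ^ 2 ∂P) * v ω t x) h2 (fun t _ x => ?_) hg h3 ht htT
  have : 0 ≤ ∫ ω', (v ω' t x) ^ 2 ∂P := integral_nonneg fun _ => sq_nonneg _
  have h : v ω t x * (α * (∫ ω', (v ω' t x) ^ 2 ∂P) * v ω t x) =
    α * (∫ ω', (v ω' t x) ^ 2 ∂P) * v ω t x ^ 2 := by ring
  rw [h]; positivity

/-- The nonlinearity in the equation for the difference of two solutions. -/
noncomputable def meanFieldDiff (P : Measure Ω) (α : ℝ) (u v : Ω → ℝ → Plane → ℝ) (ω : Ω)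
    (t : ℝ) (x : Plane) : ℝ :=
  α * ((∫ ω', u ω' t x ^ 2 ∂P) * u ω t x - (∫ ω', v ω' t x ^ 2 ∂P) * v ω t x)

theorem IsSolution.ae_equation_sub (hu : IsSolution P m α v₀ u) (hv : IsSolution P m α v₀ v) :
    ∀ᵐ ω ∂P, ContDiffOn ℝ ((⊤ : ℕ∞) : WithTop ℕ∞)
        (fun p : ℝ × Plane => u ω p.1 p.2 - v ω p.1 p.2) (Set.Ioi 0 ×ˢ Set.univ) ∧
      ∀ t, 0 < t → ∀ x, deriv (fun s => u ω s x - v ω s x) t =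
        1 / 2 * Laplacian.laplacian (fun y => u ω t y - v ω t y) x +
          m * (u ω t x - v ω t x) - meanFieldDiff P α u v ω t x := by
  filter_upwards [hu.smooth, hu.equation, hv.smooth, hv.equation] with ω h1 h2 h3 h4
  refine ⟨h1.sub h3, fun t ht x => ?_⟩
  rw [deriv_fun_sub (hasDerivAt_time h1 ht x).differentiableAt
    (hasDerivAt_time h3 ht x).differentiableAt, h2 t ht x, h4 t ht x]
  have h := (contDiff_slice h1 ht).contDiffAt.laplacian_sub
    (contDiff_slice h3 ht).contDiffAt (x := x)
  have h' : Laplacian.laplacian (fun y => u ω t y - v ω t y) x =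
    Laplacian.laplacian (u ω t) x - Laplacian.laplacian (v ω t) x := h
  rw [h', meanFieldDiff]
  ring

theorem IsSolution.ae_growth_sub (hu : IsSolution P m α v₀ u) (hv : IsSolution P m α v₀ v)
    {T : ℝ} (hT : 0 < T) : ∀ᵐ ω ∂P, ∃ M r : ℝ, ∀ τ, 0 ≤ τ → τ ≤ T → ∀ x,
      |u ω τ x - v ω τ x| ≤ M * Real.exp (r * ‖x‖) := by
  filter_upwards [hu.growth T hT, hv.growth T hT] with ω h1 h2
  obtain ⟨M₁, r₁, hM₁, h1⟩ := h1.exists_bound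
  obtain ⟨M₂, r₂, hM₂, h2⟩ := h2.exists_bound
  refine ⟨M₁ + M₂, max r₁ r₂, fun τ h0 hτ x => ?_⟩
  calc |u ω τ x - v ω τ x| ≤ |u ω τ x| + |v ω τ x| := abs_sub _ _
    _ ≤ M₁ * Real.exp (r₁ * ‖x‖) + M₂ * Real.exp (r₂ * ‖x‖) :=
      add_le_add (h1 τ h0 hτ x) (h2 τ h0 hτ x)
    _ ≤ M₁ * Real.exp (max r₁ r₂ * ‖x‖) + M₂ * Real.exp (max r₁ r₂ * ‖x‖) := by
      gcongr
      · exact le_max_left _ _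
      · exact le_max_right _ _
    _ = _ := by ring

/-- By `(u - v)² ≤ 2u² + 2v²`, with both energies below the same initial one. The bound is free of
the path's growth constants, so it can dominate under the expectation. -/
theorem IsSolution.ae_energy_sub_le (hα : 0 < α) (hu : IsSolution P m α v₀ u)
    (hv : IsSolution P m α v₀ v) {T : ℝ} (hT : 0 < T) :
    ∀ᵐ ω ∂P, ∀ t, 0 < t → t ≤ T → ∫ x, gaussWeight m T t x ^ 2 * (u ω t x - v ω t x) ^ 2 ≤
      4 * ∫ x, gaussWeight m T 0 x ^ 2 * v₀ ω x ^ 2 := by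
  filter_upwards [hu.ae_energy_le hα hT, hv.ae_energy_le hα hT, hu.smooth, hv.smooth,
    hu.growth T hT, hv.growth T hT] with ω h1 h2 h3 h4 h5 h6 t ht htT
  obtain ⟨M₁, r₁, -, h5⟩ := h5.exists_bound
  obtain ⟨M₂, r₂, -, h6⟩ := h6.exists_bound
  have hi1 := integrable_gaussWeight_sq_mul_sq (m := m) ht.le htT
    (continuous_slice h3.continuousOn ht).aestronglyMeasurable (h5 t ht.le htT)
  have hi2 := integrable_gaussWeight_sq_mul_sq (m := m) ht.le htT
    (continuous_slice h4.continuousOn ht).aestronglyMeasurable (h6 t ht.le htT)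
  have h : ∫ x, gaussWeight m T t x ^ 2 * (u ω t x - v ω t x) ^ 2 ≤
      ∫ x, (2 * (gaussWeight m T t x ^ 2 * u ω t x ^ 2) +
        2 * (gaussWeight m T t x ^ 2 * v ω t x ^ 2)) := by
    refine integral_mono_of_nonneg (.of_forall fun x => by positivity)
      ((hi1.const_mul 2).add (hi2.const_mul 2)) (.of_forall fun x => ?_)
    simp only
    nlinarith [sq_nonneg (gaussWeight m T t x * (u ω t x + v ω t x))]
  rw [integral_add (hi1.const_mul 2) (hi2.const_mul 2), integral_const_mul,
    integral_const_mul] at h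
  linarith [h1 t ht htT, h2 t ht htT]

theorem IsSolution.exists_sq_bound (hv : IsSolution P m α v₀ v) {T : ℝ} (hT : 0 < T)
    {K : Set Plane} (hK : IsCompact K) :
    ∃ B : ℝ, 0 ≤ B ∧ ∀ τ, 0 ≤ τ → τ ≤ T → ∀ x ∈ K, ∫ ω, v ω τ x ^ 2 ∂P ≤ B := by
  obtain ⟨M, r, hM, h⟩ := (hv.growth_sq T hT).exists_bound
  obtain ⟨R, hR⟩ := hK.isBounded.exists_norm_le
  refine ⟨M * Real.exp (|r| * |R|), by positivity, fun τ h0 hτ x hx => (h τ h0 hτ x).trans ?_⟩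
  have : r * ‖x‖ ≤ |r| * |R| := mul_le_mul (le_abs_self r) ((hR x hx).trans (le_abs_self R))
    (norm_nonneg _) (abs_nonneg _)
  gcongr

/-! ### Integrability over `Ω × (s, T] × ℝ²`. -/

variable [SFinite P]

theorem IsSolution.aestronglyMeasurable_slice (hv : IsSolution P m α v₀ v) {t : ℝ} (ht : 0 < t) :
    AEStronglyMeasurable (fun p : Ω × Plane => v p.1 t p.2) (P.prod volume) :=
  aestronglyMeasurable_prod_of_ae_continuous volume
    (fun x => (hv.memLp t ht.le x).aestronglyMeasurable)
    (hv.smooth.mono fun _ h => continuous_slice h.continuousOn ht)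

theorem IsSolution.aestronglyMeasurable_prod (hv : IsSolution P m α v₀ v) {s : ℝ} (hs : 0 < s)
    (T : ℝ) : AEStronglyMeasurable (fun p : Ω × (ℝ × Plane) => v p.1 p.2.1 p.2.2)
      (P.prod (((volume : Measure ℝ).restrict (Set.Ioc s T)).prod (volume : Measure Plane))) := by
  have h := aestronglyMeasurable_prod_of_ae_continuous (P := P)
    (((volume : Measure ℝ).restrict (Set.Ioc s T)).prod (volume : Measure Plane))
    -- Freezing time below `s` yields a field continuous on all of `ℝ × ℝ²` that agrees with `v` on
    -- `(s, T]`.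
    (u := fun ω p => v ω (max p.1 s) p.2)
    (fun p => (hv.memLp _ (hs.le.trans (le_max_right _ _)) _).aestronglyMeasurable)
    (hv.smooth.mono fun ω h => by
      have hc : Continuous fun p : ℝ × Plane => (max p.1 s, p.2) := by fun_prop
      exact h.continuousOn.comp_continuous hc
        fun p => ⟨lt_of_lt_of_le hs (le_max_right _ _), trivial⟩)
  refine h.congr ?_
  have h1 : ∀ᵐ z ∂(((volume : Measure ℝ).restrict (Set.Ioc s T)).prod (volume : Measure Plane)),
      z.1 ∈ Set.Ioc s T :=
    Measure.quasiMeasurePreserving_fst.ae (ae_restrict_mem measurableSet_Ioc)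
  filter_upwards [Measure.quasiMeasurePreserving_snd.ae h1] with p hp
  rw [max_eq_left hp.1.le]

theorem IsSolution.aestronglyMeasurable_sq (hv : IsSolution P m α v₀ v) {s : ℝ} (hs : 0 < s)
    (T : ℝ) : AEStronglyMeasurable (fun z : ℝ × Plane => ∫ ω, v ω z.1 z.2 ^ 2 ∂P)
      (((volume : Measure ℝ).restrict (Set.Ioc s T)).prod (volume : Measure Plane)) :=
  (((hv.aestronglyMeasurable_prod hs T).pow 2).prod_swap).integral_prod_right'

/-- The weighted energy of the initial value is integrable. -/
theorem integrable_initial_energy {T : ℝ} (hT : 0 ≤ T)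
    (hmeas : AEMeasurable (fun p : Ω × Plane => v₀ p.1 p.2) (P.prod volume))
    (hL2 : ∀ x : Plane, MemLp (fun ω => v₀ ω x) 2 P)
    (hC₀ : BddAbove (Set.range fun x : Plane => ∫ ω, (v₀ ω x) ^ 2 ∂P)) :
    Integrable (fun ω => ∫ x, gaussWeight m T 0 x ^ 2 * v₀ ω x ^ 2) P := by
  obtain ⟨C, hC⟩ := hC₀
  have hγ : Continuous (gaussWeight m T 0 : Plane → ℝ) :=
    (contDiff_gaussWeight m T 0 (n := 0)).continuous
  have hmeas' : AEStronglyMeasurable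
      (fun p : Ω × Plane => gaussWeight m T 0 p.2 ^ 2 * v₀ p.1 p.2 ^ 2) (P.prod volume) :=
    (hγ.pow 2).aestronglyMeasurable.comp_snd.mul
      (hmeas.aestronglyMeasurable.pow 2)
  have hint : Integrable
      (fun p : Ω × Plane => gaussWeight m T 0 p.2 ^ 2 * v₀ p.1 p.2 ^ 2) (P.prod volume) := by
    rw [integrable_prod_iff' hmeas']
    refine ⟨.of_forall fun x => (hL2 x).integrable_sq.const_mul (gaussWeight m T 0 x ^ 2), ?_⟩
    have hdom : Integrable fun x : Plane => gaussWeight m T 0 x ^ 2 * C := by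
      -- The constant function 1 has growth constants `M = 1`, `r = 0`, so this is integrability of
      -- the weight itself.
      have h := integrable_gaussWeight_sq_mul_sq (E := Plane) (m := m) (M := 1) (r := 0) le_rfl hT
        (f := fun _ => 1) aestronglyMeasurable_const (by simp)
      simpa using h.mul_const C
    refine hdom.mono' hmeas'.norm.prod_swap.integral_prod_right' (.of_forall fun x => ?_)
    rw [Real.norm_of_nonneg (integral_nonneg fun _ => norm_nonneg _)]
    simp only [norm_mul, norm_pow, Real.norm_eq_abs, sq_abs]
    rw [integral_const_mul]
    gcongr
    exact hC ⟨x, rfl⟩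
  exact hint.integral_prod_left

theorem IsSolution.integrable_prod_sq (hv : IsSolution P m α v₀ v) {s T : ℝ} (hs : 0 < s)
    (hsT : s ≤ T) {φ : ℝ → Plane → ℝ} (hφ : Continuous fun p : ℝ × Plane => φ p.1 p.2)
    {K : Set Plane} (hK : IsCompact K) (hsupp : ∀ τ, ∀ x ∉ K, φ τ x = 0) :
    Integrable (fun p : Ω × (ℝ × Plane) => φ p.2.1 p.2.2 * v p.1 p.2.1 p.2.2 ^ 2)
      (P.prod (((volume : Measure ℝ).restrict (Set.Ioc s T)).prod (volume : Measure Plane))) := by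
  obtain ⟨B, hB0, hB⟩ := hv.exists_sq_bound (hs.trans_le hsT) hK
  have hmeas : AEStronglyMeasurable
      (fun p : Ω × (ℝ × Plane) => φ p.2.1 p.2.2 * v p.1 p.2.1 p.2.2 ^ 2)
      (P.prod (((volume : Measure ℝ).restrict (Set.Ioc s T)).prod (volume : Measure Plane))) :=
    hφ.aestronglyMeasurable.comp_snd.mul ((hv.aestronglyMeasurable_prod hs T).pow 2)
  have hmem : ∀ᵐ z ∂(((volume : Measure ℝ).restrict (Set.Ioc s T)).prod
      (volume : Measure Plane)), z.1 ∈ Set.Ioc s T :=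
    Measure.quasiMeasurePreserving_fst.ae (ae_restrict_mem measurableSet_Ioc)
  rw [integrable_prod_iff' hmeas]
  refine ⟨?_, ?_⟩
  · filter_upwards [hmem] with z hz
    exact (hv.memLp z.1 (hs.trans hz.1).le z.2).integrable_sq.const_mul _
  · have hdom := (integrable_prod_of_continuousOn_Ioi hK hφ.continuousOn hsupp (t := T)
      hs).norm.mul_const B
    refine hdom.mono' hmeas.norm.prod_swap.integral_prod_right' ?_
    filter_upwards [hmem] with z hz
    rw [Real.norm_of_nonneg (integral_nonneg fun _ => norm_nonneg _)]
    simp only [norm_mul, norm_pow, Real.norm_eq_abs, sq_abs]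
    rw [integral_const_mul]
    by_cases hzK : z.2 ∈ K
    · gcongr
      exact hB z.1 (hs.trans hz.1).le hz.2 z.2 hzK
    · simp [hsupp z.1 z.2 hzK]

/-- The localized dissipation of the difference of two solutions. -/
theorem IsSolution.integrable_dissipation (hu : IsSolution P m α v₀ u)
    (hv : IsSolution P m α v₀ v) {s T : ℝ} (hs : 0 < s) (hsT : s ≤ T) {φ : ℝ → Plane → ℝ}
    (hφ : Continuous fun p : ℝ × Plane => φ p.1 p.2) {K : Set Plane} (hK : IsCompact K)
    (hsupp : ∀ τ, ∀ x ∉ K, φ τ x = 0) :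
    Integrable (fun p : Ω × (ℝ × Plane) => φ p.2.1 p.2.2 *
        ((u p.1 p.2.1 p.2.2 - v p.1 p.2.1 p.2.2) * meanFieldDiff P α u v p.1 p.2.1 p.2.2))
      (P.prod (((volume : Measure ℝ).restrict (Set.Ioc s T)).prod (volume : Measure Plane))) := by
  obtain ⟨A, hA0, hA⟩ := hu.exists_sq_bound (hs.trans_le hsT) hK
  obtain ⟨B, hB0, hB⟩ := hv.exists_sq_bound (hs.trans_le hsT) hK
  have hum := hu.aestronglyMeasurable_prod hs T
  have hvm := hv.aestronglyMeasurable_prod hs T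
  have ham := (hu.aestronglyMeasurable_sq hs T).comp_snd (μ := P)
  have hbm := (hv.aestronglyMeasurable_sq hs T).comp_snd (μ := P)
  have hdom := (((hu.integrable_prod_sq hs hsT hφ hK hsupp).norm.add
    (hv.integrable_prod_sq hs hsT hφ hK hsupp).norm)).const_mul (2 * |α| * (A + B))
  refine hdom.mono' ?_ ?_
  · simp only [meanFieldDiff]
    exact hφ.aestronglyMeasurable.comp_snd.mul ((hum.sub hvm).mul
      (((ham.mul hum).sub (hbm.mul hvm)).const_mul α))
  · have hmem : ∀ᵐ z ∂(((volume : Measure ℝ).restrict (Set.Ioc s T)).prod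
        (volume : Measure Plane)), z.1 ∈ Set.Ioc s T :=
      Measure.quasiMeasurePreserving_fst.ae (ae_restrict_mem measurableSet_Ioc)
    filter_upwards [Measure.quasiMeasurePreserving_snd.ae hmem] with p hp
    by_cases hpK : p.2.2 ∈ K
    · have h1 := hA p.2.1 (hs.trans hp.1).le hp.2 p.2.2 hpK
      have h2 := hB p.2.1 (hs.trans hp.1).le hp.2 p.2.2 hpK
      simp only [meanFieldDiff, norm_mul, norm_pow, Real.norm_eq_abs, Pi.add_apply]
      have h3 : 0 ≤ ∫ ω, u ω p.2.1 p.2.2 ^ 2 ∂P := integral_nonneg fun _ => sq_nonneg _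
      have h4 : 0 ≤ ∫ ω, v ω p.2.1 p.2.2 ^ 2 ∂P := integral_nonneg fun _ => sq_nonneg _
      set a := ∫ ω, u ω p.2.1 p.2.2 ^ 2 ∂P
      set b := ∫ ω, v ω p.2.1 p.2.2 ^ 2 ∂P
      set U := u p.1 p.2.1 p.2.2
      set V := v p.1 p.2.1 p.2.2
      have h5 : |U - V| ≤ |U| + |V| := abs_sub _ _
      have h6 : |a * U - b * V| ≤ (A + B) * (|U| + |V|) := by
        refine (abs_sub _ _).trans ?_
        rw [abs_mul, abs_mul, abs_of_nonneg h3, abs_of_nonneg h4]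
        nlinarith [abs_nonneg U, abs_nonneg V]
      calc |φ p.2.1 p.2.2| * (|U - V| * (|α| * |a * U - b * V|))
          ≤ |φ p.2.1 p.2.2| * ((|U| + |V|) * (|α| * ((A + B) * (|U| + |V|)))) := by gcongr
        _ = |φ p.2.1 p.2.2| * |α| * (A + B) * (|U| + |V|) ^ 2 := by ring
        _ ≤ |φ p.2.1 p.2.2| * |α| * (A + B) * (2 * (|U| ^ 2 + |V| ^ 2)) := by
          gcongr; exact add_sq_le
        _ = _ := by ring
    · simp [hsupp _ _ hpK]

/-- Fubini moves the expectation inside, where monotonicity of the mean field applies at each `(t,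
x)`; before that the integrand has no sign. -/
theorem IsSolution.integral_dissipation_nonneg (hα : 0 < α) (hu : IsSolution P m α v₀ u)
    (hv : IsSolution P m α v₀ v) {s T : ℝ} (hs : 0 < s) (hsT : s ≤ T) {φ : ℝ → Plane → ℝ}
    (hφ : Continuous fun p : ℝ × Plane => φ p.1 p.2) (hφ0 : ∀ τ x, 0 ≤ φ τ x) {K : Set Plane}
    (hK : IsCompact K) (hsupp : ∀ τ, ∀ x ∉ K, φ τ x = 0) :
    0 ≤ ∫ ω, ∫ z, φ z.1 z.2 * ((u ω z.1 z.2 - v ω z.1 z.2) * meanFieldDiff P α u v ω z.1 z.2)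
      ∂(((volume : Measure ℝ).restrict (Set.Ioc s T)).prod (volume : Measure Plane)) ∂P := by
  rw [integral_integral_swap (hu.integrable_dissipation hv hs hsT hφ hK hsupp)]
  have hmem : ∀ᵐ z ∂(((volume : Measure ℝ).restrict (Set.Ioc s T)).prod
      (volume : Measure Plane)), z.1 ∈ Set.Ioc s T :=
    Measure.quasiMeasurePreserving_fst.ae (ae_restrict_mem measurableSet_Ioc)
  refine integral_nonneg_of_ae ?_
  filter_upwards [hmem] with z hz
  have hz0 := (hs.trans hz.1).le
  have h := integral_sub_mul_meanField_nonneg (hu.memLp z.1 hz0 z.2) (hv.memLp z.1 hz0 z.2)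
  have heq : ∀ ω, φ z.1 z.2 * ((u ω z.1 z.2 - v ω z.1 z.2) * meanFieldDiff P α u v ω z.1 z.2) =
      φ z.1 z.2 * α * ((u ω z.1 z.2 - v ω z.1 z.2) *
        ((∫ ω', u ω' z.1 z.2 ^ 2 ∂P) * u ω z.1 z.2 -
          (∫ ω', v ω' z.1 z.2 ^ 2 ∂P) * v ω z.1 z.2)) := fun ω => by
    rw [meanFieldDiff]; ring
  simp only [heq, integral_const_mul, Pi.zero_apply]
  exact mul_nonneg (mul_nonneg (hφ0 _ _) hα.le) h

end Probability

/-! ### Expected energy of the difference and its vanishing. -/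

section Uniqueness

variable {Ω : Type*} [MeasurableSpace Ω] {P : Measure Ω} {m α : ℝ}
  {v₀ : Ω → Plane → ℝ} {u v : Ω → ℝ → Plane → ℝ}

theorem IsSolution.ae_cutoff_energy_sub_le (hu : IsSolution P m α v₀ u)
    (hv : IsSolution P m α v₀ v) {t T : ℝ} (ht : 0 < t) (htT : t ≤ T) {χ : Plane → ℝ}
    (hχ0 : ∀ x, 0 ≤ χ x) (hχ1 : ∀ x, χ x ≤ 1) :
    ∀ᵐ ω ∂P, ∫ x, (gaussWeight m T t x * χ x) ^ 2 * (u ω t x - v ω t x) ^ 2 ≤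
      ∫ x, gaussWeight m T t x ^ 2 * (u ω t x - v ω t x) ^ 2 := by
  filter_upwards [hu.ae_equation_sub hv, hu.ae_growth_sub hv (ht.trans_le htT)] with ω h1 h2
  obtain ⟨M, r, hg⟩ := h2
  refine integral_mono_of_nonneg (.of_forall fun x => by positivity)
    (integrable_gaussWeight_sq_mul_sq ht.le htT (continuous_slice (w := fun t x =>
      u ω t x - v ω t x) h1.1.continuousOn ht).aestronglyMeasurable (hg t ht.le htT))
    (.of_forall fun x => ?_)
  simp only [mul_pow]
  have h3 : χ x ^ 2 ≤ 1 := pow_le_one₀ (hχ0 x) (hχ1 x)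
  have h4 : 0 ≤ gaussWeight m T t x ^ 2 * (u ω t x - v ω t x) ^ 2 := by positivity
  nlinarith

variable [SFinite P]

theorem IsSolution.aestronglyMeasurable_energy (hu : IsSolution P m α v₀ u)
    (hv : IsSolution P m α v₀ v) {t : ℝ} (ht : 0 < t) {ρ : Plane → ℝ} (hρ : Continuous ρ) :
    AEStronglyMeasurable (fun ω => ∫ x, ρ x ^ 2 * (u ω t x - v ω t x) ^ 2) P :=
  ((hρ.pow 2).aestronglyMeasurable.comp_snd.mul (((hu.aestronglyMeasurable_slice ht).sub
    (hv.aestronglyMeasurable_slice ht)).pow 2)).integral_prod_right'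

theorem IsSolution.integrable_energy_sub (hα : 0 < α) (hu : IsSolution P m α v₀ u)
    (hv : IsSolution P m α v₀ v) {t T : ℝ} (ht : 0 < t) (htT : t ≤ T)
    (hΦ : Integrable (fun ω => ∫ x, gaussWeight m T 0 x ^ 2 * v₀ ω x ^ 2) P) :
    Integrable (fun ω => ∫ x, gaussWeight m T t x ^ 2 * (u ω t x - v ω t x) ^ 2) P := by
  refine (hΦ.const_mul 4).mono' (hu.aestronglyMeasurable_energy hv ht
    (contDiff_gaussWeight m T t (n := 0)).continuous) ?_
  filter_upwards [hu.ae_energy_sub_le hα hv (ht.trans_le htT)] with ω h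
  rw [Real.norm_of_nonneg (integral_nonneg fun _ => by positivity)]
  exact h t ht htT

theorem IsSolution.integrable_cutoff_energy_sub (hα : 0 < α) (hu : IsSolution P m α v₀ u)
    (hv : IsSolution P m α v₀ v) {t T : ℝ} (ht : 0 < t) (htT : t ≤ T)
    (hΦ : Integrable (fun ω => ∫ x, gaussWeight m T 0 x ^ 2 * v₀ ω x ^ 2) P) {χ : Plane → ℝ}
    (hχ : Continuous χ) (hχ0 : ∀ x, 0 ≤ χ x) (hχ1 : ∀ x, χ x ≤ 1) :
    Integrable (fun ω => ∫ x, (gaussWeight m T t x * χ x) ^ 2 * (u ω t x - v ω t x) ^ 2) P := by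
  refine (hu.integrable_energy_sub hα hv ht htT hΦ).mono' (hu.aestronglyMeasurable_energy hv ht
    ((contDiff_gaussWeight m T t (n := 0)).continuous.mul hχ)) ?_
  filter_upwards [hu.ae_cutoff_energy_sub_le hv ht htT hχ0 hχ1] with ω h
  rwa [Real.norm_of_nonneg (integral_nonneg fun _ => by positivity)]

/-- Expected localized energy inequality for the difference of two solutions. -/
theorem IsSolution.integral_cutoff_energy_sub_le (hα : 0 < α) (hu : IsSolution P m α v₀ u)
    (hv : IsSolution P m α v₀ v) {s t T : ℝ} (hs : 0 < s) (hst : s ≤ t) (htT : t ≤ T)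
    (hΦ : Integrable (fun ω => ∫ x, gaussWeight m T 0 x ^ 2 * v₀ ω x ^ 2) P) {χ : Plane → ℝ}
    (hχ : ContDiff ℝ 1 χ) (hc : HasCompactSupport χ) (hχ0 : ∀ x, 0 ≤ χ x) (hχ1 : ∀ x, χ x ≤ 1)
    {L : ℝ} (hL0 : 0 ≤ L)
    (hL : ∀ x, ∑ i, (fderiv ℝ χ x (EuclideanSpace.basisFun (Fin 2) ℝ i)) ^ 2 ≤ L) :
    ∫ ω, (∫ x, (gaussWeight m T t x * χ x) ^ 2 * (u ω t x - v ω t x) ^ 2) ∂P ≤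
      (∫ ω, (∫ x, gaussWeight m T s x ^ 2 * (u ω s x - v ω s x) ^ 2) ∂P) +
        2 * T * L * (4 * ∫ ω, (∫ x, gaussWeight m T 0 x ^ 2 * v₀ ω x ^ 2) ∂P) := by
  have hT : 0 < T := hs.trans_le (hst.trans htT)
  set φ : ℝ → Plane → ℝ := fun τ x => (gaussWeight m T τ x * χ x) ^ 2 with hφ
  have hφc : Continuous fun p : ℝ × Plane => φ p.1 p.2 :=
    ((continuous_gaussWeight m T).mul (hχ.continuous.comp continuous_snd)).pow 2
  have hφs : ∀ τ, ∀ x ∉ tsupport χ, φ τ x = 0 := fun τ x hx => by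
    simp [hφ, image_eq_zero_of_notMem_tsupport hx]
  have hdiss := hu.integrable_dissipation hv hs hst hφc hc hφs
  have hnonneg := hu.integral_dissipation_nonneg hα hv hs hst hφc (fun _ _ => sq_nonneg _) hc hφs
  set D : Ω → ℝ := fun ω => ∫ z, φ z.1 z.2 * ((u ω z.1 z.2 - v ω z.1 z.2) *
    meanFieldDiff P α u v ω z.1 z.2)
      ∂(((volume : Measure ℝ).restrict (Set.Ioc s t)).prod (volume : Measure Plane)) with hD
  have hDi : Integrable D P := hdiss.integral_prod_left
  have hpath : ∀ᵐ ω ∂P,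
      (∫ x, (gaussWeight m T t x * χ x) ^ 2 * (u ω t x - v ω t x) ^ 2) + 2 * D ω ≤
      (∫ x, gaussWeight m T s x ^ 2 * (u ω s x - v ω s x) ^ 2) +
        2 * T * L * (4 * ∫ x, gaussWeight m T 0 x ^ 2 * v₀ ω x ^ 2) := by
    filter_upwards [hu.ae_equation_sub hv, hu.ae_growth_sub hv hT,
      hu.ae_energy_sub_le hα hv hT, hdiss.prod_right_ae] with ω h1 h2 h3 h4
    obtain ⟨M, r, hg⟩ := h2
    have h5 := energy_inequality_of_bound (EuclideanSpace.basisFun (Fin 2) ℝ)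
      (w := fun t x => u ω t x - v ω t x) h1.1 h1.2 hg hχ hc hχ0 hχ1 hL0 hL hs hst htT h3
      -- Here `J` is the exact localized nonlinear term, since its sign appears only after taking
      -- expectations. It is integrable in time for almost every `ω` by Fubini.
      (J := fun τ => ∫ x, φ τ x * ((u ω τ x - v ω τ x) * meanFieldDiff P α u v ω τ x))
      ((intervalIntegrable_iff_integrableOn_Ioc_of_le hst).2 h4.integral_prod_left)
      (.of_forall fun τ => le_rfl)
    rw [intervalIntegral.integral_of_le hst] at h5
    simp only [hD]
    rw [integral_prod _ h4]
    exact h5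
  have hI1 := hu.integrable_cutoff_energy_sub hα hv (hs.trans_le hst) htT hΦ hχ.continuous hχ0 hχ1
  have hI2 := hu.integrable_energy_sub hα hv hs (hst.trans htT) hΦ
  have h := integral_mono_ae (hI1.add (hDi.const_mul 2))
    (hI2.add ((hΦ.const_mul 4).const_mul (2 * T * L))) hpath
  simp only [Pi.add_apply] at h
  rw [integral_add hI1 (hDi.const_mul 2), integral_add hI2 ((hΦ.const_mul 4).const_mul _),
    integral_const_mul, integral_const_mul, integral_const_mul] at h
  linarith

/-- Each path's energy tends to zero because both solutions have the same initial trace; the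
integrable initial energy, times 4, dominates. -/
theorem IsSolution.tendsto_integral_energy_sub (hα : 0 < α) (hu : IsSolution P m α v₀ u)
    (hv : IsSolution P m α v₀ v) {T : ℝ} (hT : 0 < T)
    (hΦ : Integrable (fun ω => ∫ x, gaussWeight m T 0 x ^ 2 * v₀ ω x ^ 2) P) :
    Tendsto (fun s => ∫ ω, (∫ x, gaussWeight m T s x ^ 2 * (u ω s x - v ω s x) ^ 2) ∂P)
      (𝓝[>] 0) (𝓝 0) := by
  have hev : ∀ᶠ s in 𝓝[>] (0 : ℝ), s ∈ Set.Ioc 0 T := Ioc_mem_nhdsGT hT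
  suffices h : Tendsto (fun s => ∫ ω, (∫ x, gaussWeight m T s x ^ 2 *
      (u ω s x - v ω s x) ^ 2) ∂P) (𝓝[>] 0) (𝓝 (∫ _ : Ω, (0 : ℝ) ∂P)) by
    simpa only [integral_zero] using h
  refine tendsto_integral_filter_of_dominated_convergence _ ?_ ?_ (hΦ.const_mul 4) ?_
  · filter_upwards [hev] with s hs
    exact (hu.integrable_energy_sub hα hv hs.1 hs.2 hΦ).aestronglyMeasurable
  · filter_upwards [hev] with s hs
    filter_upwards [hu.ae_energy_sub_le hα hv hT] with ω h
    rw [Real.norm_of_nonneg (integral_nonneg fun _ => by positivity)]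
    exact h s hs.1 hs.2
  · filter_upwards [hu.ae_equation_sub hv, hu.ae_growth_sub hv hT, hu.tendsto_initial,
      hv.tendsto_initial] with ω h1 h2 h3 h4
    obtain ⟨M, r, hg⟩ := h2
    have h := tendsto_energy_initial (m := m) hT (w := fun t x => u ω t x - v ω t x)
      (w₀ := fun _ => 0) h1.1.continuousOn hg
      (by filter_upwards [h3, h4] with x h5 h6; simpa using h5.sub h6)
    simpa using h

theorem IsSolution.integral_energy_sub_eq_zero (hα : 0 < α) (hu : IsSolution P m α v₀ u)
    (hv : IsSolution P m α v₀ v) {T : ℝ} (hT : 0 < T)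
    (hΦ : Integrable (fun ω => ∫ x, gaussWeight m T 0 x ^ 2 * v₀ ω x ^ 2) P) :
    ∫ ω, (∫ x, gaussWeight m T T x ^ 2 * (u ω T x - v ω T x) ^ 2) ∂P = 0 := by
  obtain ⟨χ, K, hK, hχ⟩ := exists_cutoff (EuclideanSpace.basisFun (Fin 2) ℝ)
  set A := ∫ ω, (∫ x, gaussWeight m T 0 x ^ 2 * v₀ ω x ^ 2) ∂P with hA
  have hn : ∀ n : ℕ,
      ∫ ω, (∫ x, (gaussWeight m T T x * χ n x) ^ 2 * (u ω T x - v ω T x) ^ 2) ∂P ≤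
        2 * T * (K / ((n : ℝ) + 1) ^ 2) * (4 * A) := by
    intro n
    obtain ⟨h1, h2, h3, h4, -, h6⟩ := hχ n
    -- The limit `s ↓ 0` is taken with the cutoff fixed; only then does `n → ∞`.
    refine ge_of_tendsto (x := 𝓝[>] (0 : ℝ)) (f := fun s =>
      (∫ ω, (∫ x, gaussWeight m T s x ^ 2 * (u ω s x - v ω s x) ^ 2) ∂P) +
        2 * T * (K / ((n : ℝ) + 1) ^ 2) * (4 * A)) ?_ ?_
    · simpa using (hu.tendsto_integral_energy_sub hα hv hT hΦ).add_const
        (2 * T * (K / ((n : ℝ) + 1) ^ 2) * (4 * A))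
    · filter_upwards [Ioc_mem_nhdsGT hT] with s hs
      exact hu.integral_cutoff_energy_sub_le hα hv hs.1 hs.2 le_rfl hΦ h1 h2 h3 h4
        (by positivity) h6
  have hlim : Tendsto (fun n : ℕ =>
      ∫ ω, (∫ x, (gaussWeight m T T x * χ n x) ^ 2 * (u ω T x - v ω T x) ^ 2) ∂P) atTop
      (𝓝 (∫ ω, (∫ x, gaussWeight m T T x ^ 2 * (u ω T x - v ω T x) ^ 2) ∂P)) := by
    refine tendsto_integral_of_dominated_convergence _ (fun n =>
      (hu.integrable_cutoff_energy_sub hα hv hT le_rfl hΦ (hχ n).1.continuous (hχ n).2.2.1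
        (hχ n).2.2.2.1).aestronglyMeasurable) (hu.integrable_energy_sub hα hv hT le_rfl hΦ)
      (fun n => ?_) ?_
    · filter_upwards [hu.ae_cutoff_energy_sub_le hv hT le_rfl (hχ n).2.2.1
        (hχ n).2.2.2.1] with ω h
      rwa [Real.norm_of_nonneg (integral_nonneg fun _ => by positivity)]
    · filter_upwards [hu.ae_equation_sub hv, hu.ae_growth_sub hv hT] with ω h1 h2
      obtain ⟨M, r, hg⟩ := h2
      have hw := continuous_slice (w := fun t x => u ω t x - v ω t x) h1.1.continuousOn hT
      exact tendsto_integral_cutoff (fun n => (hχ n).1.continuous) (fun n => (hχ n).2.2.1)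
        (fun n => (hχ n).2.2.2.1) (fun n => (hχ n).2.2.2.2.1) hw
        (integrable_gaussWeight_sq_mul_sq hT.le le_rfl hw.aestronglyMeasurable (hg T hT.le le_rfl))
  refine le_antisymm (le_of_tendsto_of_tendsto' hlim ?_ hn)
    (integral_nonneg fun _ => integral_nonneg fun _ => by positivity)
  simpa using ((tendsto_const_div_add_one_sq K).const_mul (2 * T)).mul_const (4 * A)

theorem IsSolution.ae_eq_at_time (hα : 0 < α) (hu : IsSolution P m α v₀ u)
    (hv : IsSolution P m α v₀ v) {T : ℝ} (hT : 0 < T)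
    (hΦ : Integrable (fun ω => ∫ x, gaussWeight m T 0 x ^ 2 * v₀ ω x ^ 2) P) :
    ∀ᵐ ω ∂P, ∀ x, u ω T x = v ω T x := by
  have h0 := (integral_eq_zero_iff_of_nonneg (fun _ => integral_nonneg fun _ => by positivity)
    (hu.integrable_energy_sub hα hv hT le_rfl hΦ)).1
      (hu.integral_energy_sub_eq_zero hα hv hT hΦ)
  filter_upwards [h0, hu.ae_equation_sub hv, hu.ae_growth_sub hv hT] with ω h h1 h2
  obtain ⟨M, r, hg⟩ := h2
  have hw := continuous_slice (w := fun t x => u ω t x - v ω t x) h1.1.continuousOn hT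
  have hi := integrable_gaussWeight_sq_mul_sq (m := m) hT.le le_rfl hw.aestronglyMeasurable
    (hg T hT.le le_rfl)
  have h3 := (integral_eq_zero_iff_of_nonneg (fun _ => by positivity) hi).1 h
  have hγ : Continuous (gaussWeight m T T : Plane → ℝ) :=
    (contDiff_gaussWeight m T T (n := 0)).continuous
  have h4 := (Continuous.ae_eq_iff_eq volume (by fun_prop) continuous_zero).1 h3
  intro x
  have h5 := congrFun h4 x
  have h6 := (gaussWeight_pos m T T x).ne'
  simpa [h6, sub_eq_zero] using h5

end Uniqueness

end MeanField

theorem proposition5p1 {Ω : Type*} [MeasurableSpace Ω] (P : Measure Ω) [IsProbabilityMeasure P]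
    (m α : ℝ) (hα : 0 < α) (v₀ : Ω → MeanField.Plane → ℝ)
    (hmeas : AEMeasurable (fun p : Ω × MeanField.Plane => v₀ p.1 p.2) (P.prod volume))
    (hgrowth : ∀ᵐ ω ∂P, v₀ ω ∈ MeanField.ExpGrowth)
    (hL2 : ∀ x : MeanField.Plane, MemLp (fun ω => v₀ ω x) 2 P)
    (hC₀ : BddAbove (Set.range fun x : MeanField.Plane => ∫ ω, (v₀ ω x) ^ 2 ∂P))
    (u v : Ω → ℝ → MeanField.Plane → ℝ)
    (hu : MeanField.IsSolution P m α v₀ u) (hv : MeanField.IsSolution P m α v₀ v) :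
    ∀ᵐ ω ∂P, ∀ t : ℝ, 0 ≤ t → ∀ x : MeanField.Plane, u ω t x = v ω t x := by
  -- The null set at a fixed time depends on that time, hence countably many times; each `q` is the
  -- terminal time `T` of its own weight.
  have hrat : ∀ᵐ ω ∂P, ∀ q : ℚ, 0 < (q : ℝ) → ∀ x, u ω q x = v ω q x := by
    refine ae_all_iff.2 fun q => ?_
    by_cases hq : 0 < (q : ℝ)
    · filter_upwards [hu.ae_eq_at_time hα hv hq
        (MeanField.integrable_initial_energy hq.le hmeas hL2 hC₀)] with ω h _
      exact h
    · exact .of_forall fun ω h => absurd h hq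
  filter_upwards [hrat, hu.smooth, hv.smooth, hu.initial, hv.initial] with ω h h1 h2 h3 h4 t ht x
  rcases ht.eq_or_lt with rfl | ht
  · rw [h3, h4]
  have hc1 := (MeanField.hasDerivAt_time h1 ht x).continuousAt
  have hc2 := (MeanField.hasDerivAt_time h2 ht x).continuousAt
  by_contra hne
  -- A nonzero difference at `t` would persist near `t`, hence at a positive rational time.
  have hev : {s : ℝ | u ω s x - v ω s x ≠ 0 ∧ 0 < s} ∈ 𝓝 t :=
    ((hc1.sub hc2).eventually_ne (sub_ne_zero.2 hne)).and (lt_mem_nhds ht)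
  obtain ⟨q, hq1, hq2⟩ := Rat.denseRange_cast.mem_nhds hev
  exact hq1 (sub_eq_zero.2 (h q hq2 x))
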